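/- Let $\mathcal C$ be a field of characteristic zero, let $\sigma_x,\sigma_y$ be the shifts $x\mapsto x+1$, $y\mapsto y+1$ on $\mathcal C(x,y)$, and let $\mathbb D$ be a commutative ring extension of $\mathcal C(x,y)$ with commuting endomorphisms extending $\sigma_x,\sigma_y$. Put $\Delta_y=\sigma_y-1$. A hypergeometric term is a nonzero $T\in\mathbb D$ with $\sigma_x(T)=fT$ and $\sigma_y(T)=gT$ for some $f,g\in\mathcal C(x,y)$. A telescoper for $T$ is a nonzero operator $L=\sum_{i=0}^{\rho} e_iS_x^i$ with $e_i\in\mathcal C(x)$ such that $L(T)=\sum_i e_i\sigma_x^i(T)=\Delta_y(G)$ for some hypergeometric term $G\in\mathbb D$; its order is the largest $i$ with $e_i\ne0$, and it is minimal if its order is least possible. Let $T=SH$ be a hypergeometric term, where $S\in\mathcal C(x,y)$ and $H$ is a hypergeometric term whose $y$-shift quotient $K=\sigma_y(H)/H\neq 0$ is shift-reduced with respect to $y$ (its numerator is coprime with $\sigma_y^n$ of its denominator for all $n\in\mathbb Z$). Write $K=u/v$ with $u,v\in\mathcal C(x)[y]$, $\gcd(u,v)=1$. Let $\mathbb W_K$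 be the $\mathcal C(x)$-span of all $y^\ell$ such that $\ell$ is not the degree of any nonzero polynomial in the image of $p\mapsto u\,\sigma_y(p)-v\,p$ on $\mathcal C(x)[y]$. Suppose $$T=\Delta_y(gH)+\Big(\frac ab+\frac qv\Big)H,$$ where $g\in\mathcal C(x,y)$, $a,b\in\mathcal C(x)[y]$, $b\neq 0$, $\deg_y a<\deg_y b$, $\gcd(a,b)=1$, $q\in\mathbb W_K$, $b$ is shift-free with respect to $y$ (no two distinct roots in an algebraic closure of $\mathcal C(x)$ differ by an integer), and $b$ is strongly prime with $K$ ($\gcd(b,\sigma_y^{-i}(u))=\gcd(b,\sigma_y^{i}(v))=1$ for all $i\ge0$). Suppose further that $b$ is integer-linear: every irreducible factor in $\mathcal C[x,y]$ of its numerator and of its denominator has the form $P(\lambda x+\mu y)$ with $P\in\mathcal C[z]$, $\lambda,\mu\in\mathbb Z$. Then $b$ can be written as $$b=c\prod_{j=1}^t h_j^{\xi_j},\qquad h_j=P_j(\lambda_jx+\mu_jy),\qquad h_j^{\xi_j}=\prod_i P_j(\lambda_jx+\mu_jy+i)^{c_{j,i}}\ \text{ for }\ \xi_j=\sum_i c_{j,i}\delta^i\in\mathbb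 N[\delta],$$ where $c\in\mathcal C(x)$, $P_j\in\mathcal C[z]$, $\lambda_j,\mu_j\in\mathbb Z$, $\mu_j>0$, $\gcd(\lambda_j,\mu_j)=1$, the $h_j$ are irreducible in $\mathcal C[x,y]$ and monic with respect to the pure lexicographic order $x\prec y$, and $h_k\neq\sigma_x^m\sigma_y^n(h_j)$ for all $j\ne k$ and $m,n\in\mathbb Z$. Moreover $T$ has a telescoper, and for every such decomposition of $b$ the order of a minimal telescoper for $T$ is at most $$\max\{\deg_y u,\deg_y v\}-[\![\deg_y(v-u)\le\deg_y(u)-1]\!]+\sum_{j=1}^t\mu_j\,m_j\deg(P_j),$$ where $m_j=\max_i c_{j,i}$ is the maximum coefficient of $\xi_j$, and $[\![\varphi]\!]$ is $1$ if $\varphi$ is true and $0$ otherwise; if $u=v$ (that is, $K=1$) the bracket is $0$. -/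

import Mathlib

namespace HypTel

open Polynomial

/-! ### Shift operators

For a field `C`, the field `C(x)` is `RatFunc C`, the ring `C(x)[y]` is `(RatFunc C)[X]` and the
field `C(x,y)` is `RatFunc (RatFunc C)`. Bivariate polynomials `C[x,y]` are `C[X][X]`: the inner
variable is `x`, the outer one is `y`. -/

section Univariate

variable {F : Type*} [Field F]

/-- The `n`-th power of the shift on `F[y]`: `p(y) ↦ p(y + n)`. -/
noncomputable def polyShift (n : ℤ) (p : F[X]) : F[X] :=
  p.comp (X + C (n : F))

variable (F) in
/-- The automorphism `r(y) ↦ r(y + 1)` of `F(y)`. -/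
noncomputable def ratShift : RatFunc F ≃+* RatFunc F :=
  IsFractionRing.ringEquivOfRingEquiv (taylorEquiv (1 : F)).toRingEquiv

theorem ratShift_algebraMap (p : F[X]) :
    ratShift F (algebraMap F[X] (RatFunc F) p) = algebraMap F[X] (RatFunc F) (polyShift 1 p) := by
  have h : (taylorEquiv (1 : F)).toRingEquiv p = polyShift 1 p := by
    change taylor 1 p = _
    simp [polyShift, taylor_apply]
  rw [← h]
  exact IsFractionRing.ringEquivOfRingEquiv_algebraMap _ _

/-- A nonzero polynomial is shift-free if no two distinct roots of it (in an algebraic closure)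
differ by an integer. -/
def ShiftFree (p : F[X]) : Prop :=
  p ≠ 0 ∧ ∀ α β : AlgebraicClosure F, aeval α p = 0 → aeval β p = 0 →
    ∀ n : ℤ, α - β = (n : AlgebraicClosure F) → α = β

/-- A nonzero rational function is shift-reduced if its numerator is coprime with every shift of
its denominator. -/
def ShiftReduced (K : RatFunc F) : Prop :=
  K ≠ 0 ∧ ∀ n : ℤ, IsCoprime K.num (polyShift n K.denom)

/-- `p` is strongly prime with `K = u / v`. -/
def StronglyPrime (u v p : F[X]) : Prop :=
  p ≠ 0 ∧ ∀ i : ℕ, IsCoprime p (polyShift (-(i : ℤ)) u) ∧ IsCoprime p (polyShift (i : ℤ) v)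

/-- The map for polynomial reduction with respect to `K = u / v`: `p ↦ u σ_y(p) - v p`. -/
noncomputable def phi (u v p : F[X]) : F[X] :=
  u * polyShift 1 p - v * p

/-- The standard complement of the image of `phi u v`: the span of those powers `y ^ l` such that
`l` is not the degree of a (nonzero) polynomial in the image. -/
noncomputable def stdComplement (u v : F[X]) : Submodule F F[X] :=
  Submodule.span F {m | ∃ l : ℕ, (∀ p : F[X], (phi u v p).degree ≠ (l : WithBot ℕ)) ∧ m = X ^ l}

/-- The conditions on `a`, `b`, `q` under which `a / b + q / v` is a residual form with respect to
`K = u / v`, with significant denominator `b`. -/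
structure IsResidual (u v a b q : F[X]) : Prop where
  degree_lt : a.degree < b.degree
  coprime : IsCoprime a b
  shiftFree : ShiftFree b
  stronglyPrime : StronglyPrime u v b
  mem : q ∈ stdComplement u v

/-- The number `max {deg u, deg v} - ⟦deg (v - u) ≤ deg u - 1⟧`, where the bracket is `0` when
`u = v` is a nonzero constant (`natDegree` of the zero polynomial is `0`). -/
noncomputable def kernelBound (u v : F[X]) : ℤ :=
  ((max u.natDegree v.natDegree : ℕ) : ℤ) -
    (if ((v - u).natDegree : ℤ) ≤ (u.natDegree : ℤ) - 1 then 1 else 0)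

end Univariate

section Bivariate

variable (C : Type*) [Field C]

/-- The automorphism `σ_x` of `C(x,y)`: `f(x,y) ↦ f(x + 1,y)`. -/
noncomputable def shiftX : RatFunc (RatFunc C) ≃+* RatFunc (RatFunc C) :=
  IsFractionRing.ringEquivOfRingEquiv (mapEquiv (ratShift C))

/-- The automorphism `σ_y` of `C(x,y)`: `f(x,y) ↦ f(x,y + 1)`. -/
noncomputable def shiftY : RatFunc (RatFunc C) ≃+* RatFunc (RatFunc C) :=
  ratShift (RatFunc C)

/-- The structure of a partial difference ring extension of `(C(x,y), {σ_x, σ_y})` on a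
`C(x,y)`-algebra `D`: commuting endomorphisms that extend the two shifts. -/
structure DiffExt (D : Type*) [CommRing D] [Algebra (RatFunc (RatFunc C)) D] where
  σx : D →+* D
  σy : D →+* D
  σx_algebraMap : ∀ r, σx (algebraMap (RatFunc (RatFunc C)) D r) = algebraMap _ D (shiftX C r)
  σy_algebraMap : ∀ r, σy (algebraMap (RatFunc (RatFunc C)) D r) = algebraMap _ D (shiftY C r)
  comm : ∀ d, σx (σy d) = σy (σx d)

variable {C} {D : Type*} [CommRing D] [Algebra (RatFunc (RatFunc C)) D]

/-- Hypergeometric terms over `C(x,y)`. -/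
def DiffExt.IsHypergeometric (E : DiffExt C D) (T : D) : Prop :=
  T ≠ 0 ∧ (∃ f : RatFunc (RatFunc C), E.σx T = f • T) ∧ ∃ g : RatFunc (RatFunc C), E.σy T = g • T

/-- The difference operator `Δ_y = σ_y - 1`. -/
def DiffExt.Δy (E : DiffExt C D) (G : D) : D :=
  E.σy G - G

/-- The application `L(T) = ∑ e_i σ_x^i(T)` of a linear recurrence operator `L = ∑ e_i S_x^i` over
`C(x)`. The operator is given by its finitely supported family of coefficients `e_i ∈ C(x)`. -/
noncomputable def DiffExt.apply (E : DiffExt C D) (L : ℕ →₀ RatFunc C) (T : D) : D :=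
  L.sum fun i e => (algebraMap (RatFunc C) (RatFunc (RatFunc C)) e) • (E.σx)^[i] T

/-- The order of a linear recurrence operator: the largest `i` with `e_i ≠ 0`. -/
def order (L : ℕ →₀ RatFunc C) : ℕ :=
  L.support.sup id

/-- `L` is a telescoper for `T` with respect to `y`. -/
def DiffExt.IsTelescoper (E : DiffExt C D) (T : D) (L : ℕ →₀ RatFunc C) : Prop :=
  L ≠ 0 ∧ ∃ G : D, E.IsHypergeometric G ∧ E.apply L T = E.Δy G

/-- `L` is a telescoper for `T` of minimal order. -/
def DiffExt.IsMinimalTelescoper (E : DiffExt C D) (T : D) (L : ℕ →₀ RatFunc C) : Prop :=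
  E.IsTelescoper T L ∧ ∀ L', E.IsTelescoper T L' → order L ≤ order L'

/-! ### Integer-linear polynomials -/

/-- The bivariate polynomial `P(l x + m y)`. -/
noncomputable def linSub (P : C[X]) (l m : ℤ) : C[X][X] :=
  aeval ((l : C[X][X]) * Polynomial.C X + (m : C[X][X]) * X) P

/-- The operator `σ_x^m σ_y^n` on `C[x,y]`: `p(x,y) ↦ p(x + m, y + n)`. -/
noncomputable def biShift (m n : ℤ) (p : C[X][X]) : C[X][X] :=
  (p.map (compRingHom (X + Polynomial.C (m : C)))).comp (X + (n : C[X][X]))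

/-- Shift-equivalence of bivariate polynomials with respect to `x, y`. -/
def BiShiftEquiv (p q : C[X][X]) : Prop :=
  ∃ m n : ℤ, q = biShift m n p

/-- A bivariate polynomial is integer-linear if each of its irreducible factors is of the form
`P(l x + m y)` with `P` univariate and integers `l, m`. -/
def PolyIntegerLinear (p : C[X][X]) : Prop :=
  ∀ f : C[X][X], Irreducible f → f ∣ p → ∃ (P : C[X]) (l m : ℤ), f = linSub P l m

/-- The inclusion of `C[x,y]` in `C(x)[y]`. -/
noncomputable def toRatPoly : C[X][X] →+* (RatFunc C)[X] :=
  mapRingHom (algebraMap C[X] (RatFunc C))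

/-- A rational function in `C(x,y)` is integer-linear if its numerator and its denominator (coprime
in `C[x,y]`) are. -/
def RatIntegerLinear (r : RatFunc (RatFunc C)) : Prop :=
  ∃ p d : C[X][X], d ≠ 0 ∧ IsRelPrime p d ∧ PolyIntegerLinear p ∧ PolyIntegerLinear d ∧
    r = algebraMap (RatFunc C)[X] _ (toRatPoly p) / algebraMap (RatFunc C)[X] _ (toRatPoly d)

/-- For `h = P(l x + m y)` and `ξ = ∑ c_i δ^i` in `ℕ[δ]`, the polynomial `h ^ ξ = ∏ δ^i(h)^{c_i}`.
Here `δ = σ_x^α σ_y^β` with `α l + β m = 1`, so that `δ^i(h) = P(l x + m y + i)`. -/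
noncomputable def xiPow (P : C[X]) (l m : ℤ) (ξ : ℕ[X]) : C[X][X] :=
  ∏ i ∈ ξ.support, linSub (P.comp (X + (i : C[X]))) l m ^ ξ.coeff i

/-- The decomposition `b = c h_1^{ξ_1} ⋯ h_t^{ξ_t}` in `C(x)[y]` with `c ∈ C(x)` and pairwise
shift-inequivalent monic irreducible polynomials `h_j = P_j(l_j x + m_j y)`, where `m_j > 0`,
`gcd(l_j, m_j) = 1` and `ξ_j ∈ ℕ[δ]`. Monic refers to the pure lexicographic order `x ≺ y`. -/
structure IsDecomp (b : (RatFunc C)[X]) {t : ℕ} (c : RatFunc C) (P : Fin t → C[X])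
    (l m : Fin t → ℤ) (ξ : Fin t → ℕ[X]) : Prop where
  pos : ∀ j, 0 < m j
  coprime : ∀ j, IsCoprime (l j) (m j)
  irreducible : ∀ j, Irreducible (linSub (P j) (l j) (m j))
  monic : ∀ j, (linSub (P j) (l j) (m j)).leadingCoeff.Monic
  inequiv : ∀ i j, i ≠ j → ¬ BiShiftEquiv (linSub (P i) (l i) (m i)) (linSub (P j) (l j) (m j))
  eq : b = Polynomial.C c * ∏ j, toRatPoly (xiPow (P j) (l j) (m j) (ξ j))

/-- The maximum coefficient of `ξ`. -/
def maxCoeff (ξ : ℕ[X]) : ℕ :=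
  ξ.support.sup ξ.coeff

end Bivariate

end HypTel

open HypTel Polynomial

namespace HypTel

section Univariate

variable {F : Type*} [Field F]

/-! ### Shifts of univariate polynomials -/

/-! Put `F = C(x)`, write `σ` for the shift in `y`, and let `σ_x(H) = f H`. Since `Δ_y(s H) = (K
σ(s) - s) H`, the problem lives in `F(y)` modulo the `F`-subspace `I` of all `K σ(s) - s`. If `T = s
H`, then `σ_x^i(T) = θ^i(s) H` with the semilinear operator `θ = f σ_x`, so a nontrivial `F`-linear
relation between `s, θ(s), ..., θ^n(s)` modulo `I` is a telescoper of order at most `n`. It suffices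
to find a space `S ⊇ I` that contains `s`, is stable under `θ`, and has `dim S / I` at most the
claimed bound.

Modulo `I`, the congruence `K σ(r) ≡ r` moves denominators along `σ`-orbits. As `K` is
shift-reduced, the orbit of an irreducible `p` misses `u` or misses `v`, and this allows all shifts
of `p ^ e` to be moved to one fixed shift without raising `e` (`exists_forall_red_le`). The
polynomials `P_j(λ_j x + μ_j y + i)` fall into `μ_j` orbits under `σ`, one for each residue of `i`
modulo `μ_j`, and `σ_x` permutes these orbits. So `S` is spanned by `I`, the polynomials, and the
fractions over one `m_j`-th power per orbit (`exists_invariant_residual_space`).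

For stability, commutation of the shifts on `H` gives `σ_x(K) f = σ(f) K`. Hence `θ` preserves `I`,
and the denominator of `f` consists of factors of shifts of `u` and `v`
(`exists_denom_factorization`), which can be moved away again (`exists_forall_mul_mem_red`).

For the dimension, proper fractions over the chosen denominators give `∑ μ_j m_j deg P_j`.
Polynomials are fractions over `v`, and `phi(p) / v` lies in `I`, so they add at most the
codimension of the image of `phi`, which `rank_quotient_range_phiLin_le` bounds; `exists_relation`
combines the two counts.

The decomposition of `b` comes from unique factorization in `C[x,y]` and Gauss's lemma
(`exists_isDecomp`). -/

theorem polyShift_eq_taylor (n : ℤ) (p : F[X]) : polyShift n p = taylor (n : F) p := by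
  simp [polyShift, taylor_apply]

theorem polyShift_mul (n : ℤ) (p q : F[X]) :
    polyShift n (p * q) = polyShift n p * polyShift n q := by
  simp [polyShift]

theorem polyShift_pow (n : ℤ) (p : F[X]) (k : ℕ) : polyShift n (p ^ k) = polyShift n p ^ k := by
  simp [polyShift]

theorem polyShift_one (n : ℤ) : polyShift n (1 : F[X]) = 1 := by
  simp [polyShift]

theorem polyShift_prod {ι : Type*} (n : ℤ) (s : Finset ι) (p : ι → F[X]) :
    polyShift n (∏ i ∈ s, p i) = ∏ i ∈ s, polyShift n (p i) := by
  simp [polyShift, prod_comp]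

theorem polyShift_polyShift (m n : ℤ) (p : F[X]) :
    polyShift m (polyShift n p) = polyShift (m + n) p := by
  simp only [polyShift_eq_taylor, taylor_taylor]
  push_cast
  rfl

@[simp]
theorem polyShift_zero (p : F[X]) : polyShift 0 p = p := by
  simp [polyShift]

theorem polyShift_ne_zero {p : F[X]} (hp : p ≠ 0) (n : ℤ) : polyShift n p ≠ 0 := by
  rwa [polyShift_eq_taylor, Ne, taylor_eq_zero]

theorem natDegree_polyShift (n : ℤ) (p : F[X]) : (polyShift n p).natDegree = p.natDegree := by
  rw [polyShift_eq_taylor, natDegree_taylor]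

theorem isCoprime_polyShift_polyShift (n : ℤ) {p q : F[X]} (h : IsCoprime p q) :
    IsCoprime (polyShift n p) (polyShift n q) := by
  simp only [polyShift_eq_taylor]
  exact h.map (taylorAlgHom (n : F)).toRingHom

theorem isCoprime_polyShift_comm (m n : ℤ) {p q : F[X]} :
    IsCoprime (polyShift m p) (polyShift n q) ↔ IsCoprime p (polyShift (n - m) q) := by
  constructor
  · intro h
    have := isCoprime_polyShift_polyShift (-m) h
    rwa [polyShift_polyShift, polyShift_polyShift, neg_add_cancel, polyShift_zero,
      neg_add_eq_sub] at this
  · intro h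
    have := isCoprime_polyShift_polyShift m h
    rwa [polyShift_polyShift, add_sub_cancel] at this

theorem polyShift_dvd_polyShift (n : ℤ) {p q : F[X]} (h : p ∣ q) :
    polyShift n p ∣ polyShift n q := by
  obtain ⟨r, rfl⟩ := h
  exact ⟨_, polyShift_mul n p r⟩

/-- The product `p(y) p(y + 1) ⋯ p(y + n - 1)`. -/
noncomputable def risingProd (n : ℕ) (p : F[X]) : F[X] :=
  ∏ i ∈ Finset.range n, polyShift (i : ℤ) p

/-- The product `p(y - 1) p(y - 2) ⋯ p(y - n)`. -/
noncomputable def fallingProd (n : ℕ) (p : F[X]) : F[X] :=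
  ∏ i ∈ Finset.range n, polyShift (-(i : ℤ) - 1) p

theorem risingProd_ne_zero (n : ℕ) {p : F[X]} (hp : p ≠ 0) : risingProd n p ≠ 0 :=
  Finset.prod_ne_zero_iff.mpr fun _ _ => polyShift_ne_zero hp _

theorem fallingProd_ne_zero (n : ℕ) {p : F[X]} (hp : p ≠ 0) : fallingProd n p ≠ 0 :=
  Finset.prod_ne_zero_iff.mpr fun _ _ => polyShift_ne_zero hp _

theorem risingProd_succ (n : ℕ) (p : F[X]) :
    risingProd (n + 1) p = p * polyShift 1 (risingProd n p) := by
  rw [risingProd, Finset.prod_range_succ', risingProd, polyShift_prod, mul_comm]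
  simp [polyShift_polyShift, add_comm]

theorem fallingProd_succ (n : ℕ) (p : F[X]) :
    fallingProd (n + 1) p = polyShift (-1) (p * fallingProd n p) := by
  rw [fallingProd, Finset.prod_range_succ', fallingProd, polyShift_mul, polyShift_prod, mul_comm]
  simp only [polyShift_polyShift]
  congr 1
  refine Finset.prod_congr rfl fun i _ => ?_
  congr 1
  push_cast
  ring

theorem isCoprime_risingProd {p q : F[X]} (h : ∀ n : ℤ, IsCoprime p (polyShift n q)) (n : ℕ) :
    IsCoprime p (risingProd n q) :=
  IsCoprime.prod_right fun _ _ => h _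

theorem isCoprime_fallingProd {p q : F[X]} (h : ∀ n : ℤ, IsCoprime p (polyShift n q)) (n : ℕ) :
    IsCoprime p (fallingProd n q) :=
  IsCoprime.prod_right fun _ _ => h _

theorem polyShift_fallingProd (n : ℕ) (p : F[X]) :
    polyShift n (fallingProd n p) = risingProd n p := by
  rw [fallingProd, risingProd, polyShift_prod, ← Finset.prod_range_reflect]
  refine Finset.prod_congr rfl fun i hi => ?_
  rw [polyShift_polyShift]
  congr 1
  have := Finset.mem_range.mp hi
  omega

theorem isCoprime_shifts_risingProd {p q : F[X]} (h : ∀ n : ℤ, IsCoprime p (polyShift n q))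
    (n : ℕ) (m : ℤ) : IsCoprime p (polyShift m (risingProd n q)) := by
  rw [risingProd, polyShift_prod]
  refine IsCoprime.prod_right fun i _ => ?_
  rw [polyShift_polyShift]
  exact h _

theorem isCoprime_shifts_fallingProd {p q : F[X]} (h : ∀ n : ℤ, IsCoprime p (polyShift n q))
    (n : ℕ) (m : ℤ) : IsCoprime p (polyShift m (fallingProd n q)) := by
  rw [fallingProd, polyShift_prod]
  refine IsCoprime.prod_right fun i _ => ?_
  rw [polyShift_polyShift]
  exact h _

theorem isCoprime_shifts_symm {p q : F[X]} (h : ∀ n : ℤ, IsCoprime p (polyShift n q)) (n : ℤ) :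
    IsCoprime q (polyShift n p) := by
  have := (isCoprime_polyShift_comm n 0 (p := p) (q := q)).mpr (by simpa using h (-n))
  simpa using this.symm

/-- Only finitely many shifts of a nonzero polynomial have a common factor with another one. -/
theorem exists_forall_isCoprime_polyShift [CharZero F] {p q : F[X]} (hp : p ≠ 0) (hq : q ≠ 0) :
    ∃ N : ℕ, ∀ n : ℤ, N ≤ |n| → IsCoprime (polyShift n p) q := by
  classical
  let R := AlgebraicClosure F
  let s := (p.aroots R).toFinset ×ˢ (q.aroots R).toFinset
  -- In characteristic zero each pair of roots accounts for at most one integer difference.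
  let t : Set ℤ := {n | ∃ z ∈ s, z.1 = z.2 + (n : R)}
  have ht : t.Finite := by
    have : t ⊆ ⋃ z ∈ s, {n : ℤ | z.1 = z.2 + (n : R)} := by
      rintro n ⟨z, hz, h⟩
      simp only [Set.mem_iUnion]
      exact ⟨z, hz, h⟩
    refine (Set.Finite.biUnion s.finite_toSet fun z _ => ?_).subset this
    refine Set.Subsingleton.finite fun m hm n hn => ?_
    have h : (m : R) = n := add_left_cancel (hm.symm.trans hn)
    exact_mod_cast h
  obtain ⟨N, hN⟩ : ∃ N : ℕ, ∀ n ∈ t, |n| < N := by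
    obtain ⟨M, hM⟩ := (ht.image fun n => n.natAbs).bddAbove
    refine ⟨M + 1, fun n hn => ?_⟩
    have : n.natAbs ≤ M := hM (Set.mem_image_of_mem _ hn)
    rw [Int.abs_eq_natAbs]
    omega
  refine ⟨N, fun n hn => ?_⟩
  by_contra hc
  rw [Polynomial.isCoprime_iff_aeval_ne_zero_of_isAlgClosed F R] at hc
  push Not at hc
  obtain ⟨a, h1, h2⟩ := hc
  refine absurd (hN n ⟨(a + n, a), ?_, rfl⟩) (not_lt.mpr hn)
  simp only [s, Finset.mem_product, Multiset.mem_toFinset, mem_aroots]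
  refine ⟨⟨hp, ?_⟩, hq, h2⟩
  simpa [polyShift, aeval_comp] using h1

/-! ### Reduction modulo differences -/

theorem ratShift_C (c : F) : ratShift F (RatFunc.C c) = RatFunc.C c := by
  rw [← RatFunc.algebraMap_C, ratShift_algebraMap]
  simp [polyShift]

/-- The operator `s ↦ K σ(s) - s` on `F(y)`. -/
noncomputable def qdiff (K : RatFunc F) : RatFunc F →ₗ[F] RatFunc F where
  toFun s := K * ratShift F s - s
  map_add' s t := by simp only [map_add]; ring
  map_smul' c s := by
    simp only [RatFunc.smul_eq_C_mul, map_mul, ratShift_C, RingHom.id_apply]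
    ring

theorem qdiff_apply (K s : RatFunc F) : qdiff K s = K * ratShift F s - s := rfl

/-- The map `A ↦ A / P`. -/
noncomputable def divMap (P : F[X]) : F[X] →ₗ[F] RatFunc F where
  toFun A := algebraMap F[X] (RatFunc F) A / algebraMap F[X] (RatFunc F) P
  map_add' s t := by simp only [map_add]; ring
  map_smul' c s := by
    simp only [RatFunc.smul_eq_C_mul, Polynomial.smul_eq_C_mul, map_mul, RatFunc.algebraMap_C,
      RingHom.id_apply]
    ring

theorem divMap_apply (P A : F[X]) :
    divMap P A = algebraMap F[X] (RatFunc F) A / algebraMap F[X] (RatFunc F) P := rfl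

/-- The space of all rational functions with denominator `P`. -/
noncomputable def frac (P : F[X]) : Submodule F (RatFunc F) :=
  LinearMap.range (divMap P)

theorem div_mem_frac (A P : F[X]) :
    algebraMap F[X] (RatFunc F) A / algebraMap F[X] (RatFunc F) P ∈ frac P := ⟨A, rfl⟩

theorem algebraMap_mem_frac {P : F[X]} (hP : P ≠ 0) (A : F[X]) :
    algebraMap F[X] (RatFunc F) A ∈ frac P := by
  have := RatFunc.algebraMap_ne_zero hP
  exact ⟨A * P, by rw [divMap_apply, map_mul]; field_simp⟩

theorem frac_mono {P Q : F[X]} (hQ : Q ≠ 0) (h : P ∣ Q) : frac P ≤ frac Q := by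
  obtain ⟨R, rfl⟩ := h
  rintro _ ⟨A, rfl⟩
  have h1 := RatFunc.algebraMap_ne_zero (left_ne_zero_of_mul hQ)
  have h2 := RatFunc.algebraMap_ne_zero (right_ne_zero_of_mul hQ)
  exact ⟨A * R, by simp only [divMap_apply, map_mul]; field_simp⟩

theorem frac_mul_le {P Q : F[X]} (hP : P ≠ 0) (hQ : Q ≠ 0) (h : IsCoprime P Q) :
    frac (P * Q) ≤ frac P ⊔ frac Q := by
  obtain ⟨x, y, hxy⟩ := h
  rintro _ ⟨A, rfl⟩
  have h1 := RatFunc.algebraMap_ne_zero hP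
  have h2 := RatFunc.algebraMap_ne_zero hQ
  refine Submodule.mem_sup.mpr ⟨_, div_mem_frac (A * y) P, _, div_mem_frac (A * x) Q, ?_⟩
  rw [divMap_apply]
  conv_rhs => rw [← mul_one A, ← hxy]
  simp only [map_mul, map_add]
  field_simp
  ring

theorem frac_prod_le {ι : Type*} (s : Finset ι) (P : ι → F[X]) (hP : ∀ i ∈ s, P i ≠ 0)
    (h : (s : Set ι).Pairwise fun i j => IsCoprime (P i) (P j)) :
    frac (∏ i ∈ s, P i) ≤ frac 1 ⊔ ⨆ i ∈ s, frac (P i) := by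
  classical
  induction s using Finset.induction_on with
  | empty => simp
  | insert a s ha ih =>
    rw [Finset.prod_insert ha]
    have hs : ∏ i ∈ s, P i ≠ 0 :=
      Finset.prod_ne_zero_iff.mpr fun i hi => hP i (Finset.mem_insert_of_mem hi)
    refine (frac_mul_le (hP a (Finset.mem_insert_self a s)) hs ?_).trans ?_
    · refine IsCoprime.prod_right fun i hi => h (by simp) (by simp [hi]) ?_
      rintro rfl
      exact ha hi
    · rw [Finset.iSup_insert]
      refine sup_le (le_sup_of_le_right le_sup_left) ((ih ?_ ?_).trans ?_)
      · exact fun i hi => hP i (Finset.mem_insert_of_mem hi)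
      · exact h.mono (by simp)
      · exact sup_le_sup_left le_sup_right _

/-- The space of all rational functions that are congruent to one with denominator `P` modulo
the image of `s ↦ (u / v) σ(s) - s`. -/
noncomputable def red (u v P : F[X]) : Submodule F (RatFunc F) :=
  frac P ⊔ LinearMap.range
    (qdiff (algebraMap F[X] (RatFunc F) u / algebraMap F[X] (RatFunc F) v))

/-! ### Moving denominators along shift orbits -/

variable {u v : F[X]}

theorem frac_le_red (P : F[X]) : frac P ≤ red u v P := le_sup_left

theorem qdiff_mem_red (P : F[X]) (s : RatFunc F) :
    qdiff (algebraMap F[X] (RatFunc F) u / algebraMap F[X] (RatFunc F) v) s ∈ red u v P :=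
  Submodule.mem_sup_right ⟨s, rfl⟩

theorem red_le_red {P Q : F[X]} (h : frac P ≤ red u v Q) : red u v P ≤ red u v Q :=
  sup_le h le_sup_right

theorem mul_ratShift_mem_red {P : F[X]} {s : RatFunc F} :
    algebraMap F[X] (RatFunc F) u / algebraMap F[X] (RatFunc F) v * ratShift F s ∈ red u v P ↔
      s ∈ red u v P := by
  have h := qdiff_mem_red (u := u) (v := v) P s
  rw [qdiff_apply] at h
  exact ⟨fun hs => by simpa using Submodule.sub_mem _ hs h,
    fun hs => by simpa using Submodule.add_mem _ h hs⟩

theorem ratShift_div_polyShift_neg (A P : F[X]) :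
    ratShift F (algebraMap F[X] (RatFunc F) (polyShift (-1) A) /
      algebraMap F[X] (RatFunc F) (polyShift (-1) P)) =
      algebraMap F[X] (RatFunc F) A / algebraMap F[X] (RatFunc F) P := by
  simp [ratShift_algebraMap, polyShift_polyShift]

/-- From `x u + y v = 1`, `A / v = K · A x + A y`, and `K · A x` is congruent to the polynomial
`σ⁻¹(A x)`. Thus the factor `v` costs nothing. -/
theorem frac_denom_le_red (huv : IsCoprime u v) (hv : v ≠ 0) {P : F[X]} (hP : P ≠ 0) :
    frac v ≤ red u v P := by
  rintro _ ⟨A, rfl⟩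
  obtain ⟨x, y, hxy⟩ := huv
  have h1 := RatFunc.algebraMap_ne_zero hv
  have key : divMap v A = algebraMap F[X] (RatFunc F) u / algebraMap F[X] (RatFunc F) v *
      ratShift F (algebraMap F[X] (RatFunc F) (polyShift (-1) (A * x)) /
        algebraMap F[X] (RatFunc F) (polyShift (-1) 1)) + algebraMap F[X] (RatFunc F) (A * y) := by
    rw [ratShift_div_polyShift_neg, divMap_apply]
    conv_lhs => rw [← mul_one A, ← hxy]
    simp only [map_mul, map_add, map_one]
    field_simp
  rw [key]
  refine Submodule.add_mem _ (mul_ratShift_mem_red.mpr ?_) (frac_le_red _ (algebraMap_mem_frac hP _))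
  rw [polyShift_one, map_one, div_one]
  exact frac_le_red _ (algebraMap_mem_frac hP _)

/-- From `x u + y P = 1`, `A / (v P) = K · (A x / P) + A y / v`. The first summand is congruent to
`σ⁻¹(A x / P)`, the second to a polynomial: one step to the left removes `v`. -/
theorem frac_denom_mul_le_red (huv : IsCoprime u v) (hv : v ≠ 0) {P : F[X]} (hP : P ≠ 0)
    (h : IsCoprime u P) : frac (v * P) ≤ red u v (polyShift (-1) P) := by
  rintro _ ⟨A, rfl⟩
  obtain ⟨x, y, hxy⟩ := h
  have h1 := RatFunc.algebraMap_ne_zero hv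
  have h2 := RatFunc.algebraMap_ne_zero hP
  have key : divMap (v * P) A = algebraMap F[X] (RatFunc F) u / algebraMap F[X] (RatFunc F) v *
      ratShift F (algebraMap F[X] (RatFunc F) (polyShift (-1) (A * x)) /
        algebraMap F[X] (RatFunc F) (polyShift (-1) P)) + divMap v (A * y) := by
    rw [ratShift_div_polyShift_neg, divMap_apply, divMap_apply]
    conv_lhs => rw [← mul_one A, ← hxy]
    simp only [map_mul, map_add]
    field_simp
  rw [key]
  refine Submodule.add_mem _ (mul_ratShift_mem_red.mpr ?_) ?_
  · exact frac_le_red _ (div_mem_frac _ _)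
  · exact frac_denom_le_red huv hv (polyShift_ne_zero hP _) (div_mem_frac _ _)

/-- One step to the right: applying `K σ` cancels `u` and leaves the denominator `v σ(P)`, which
partial fractions separate. -/
theorem frac_num_mul_le_red (huv : IsCoprime u v) (hu : u ≠ 0) (hv : v ≠ 0) {P : F[X]}
    (hP : P ≠ 0) (h : IsCoprime v (polyShift 1 P)) :
    frac (polyShift (-1) u * P) ≤ red u v (polyShift 1 P) := by
  rintro _ ⟨A, rfl⟩
  have h1 := RatFunc.algebraMap_ne_zero hv
  have h2 := RatFunc.algebraMap_ne_zero hu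
  have hP' := polyShift_ne_zero hP 1
  rw [← mul_ratShift_mem_red]
  have key : algebraMap F[X] (RatFunc F) u / algebraMap F[X] (RatFunc F) v *
      ratShift F (divMap (polyShift (-1) u * P) A) = divMap (v * polyShift 1 P) (polyShift 1 A) := by
    have h3 := RatFunc.algebraMap_ne_zero hP'
    simp only [divMap_apply, map_div₀, map_mul, ratShift_algebraMap, polyShift_polyShift,
      add_neg_cancel, polyShift_zero]
    field_simp
  rw [key]
  exact (frac_mul_le hv hP' h).trans (sup_le (frac_denom_le_red huv hv hP') (frac_le_red _))
    (div_mem_frac _ _)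

/-- Each step to the left removes the factor `v` of the rising product and shifts the remaining
factors onto a shorter rising product. The factors of `v` met on the way are therefore harmless;
only those of `u` obstruct. -/
theorem frac_risingProd_mul_le_red (huv : ∀ n : ℤ, IsCoprime u (polyShift n v)) (hv : v ≠ 0)
    (n : ℕ) {P : F[X]} (hP : P ≠ 0) (h : ∀ i < n, IsCoprime u (polyShift (-(i : ℤ)) P)) :
    frac (risingProd n v * P) ≤ red u v (polyShift (-(n : ℤ)) P) := by
  induction n generalizing P with
  | zero => simpa [risingProd] using frac_le_red P
  | succ n ih =>
    rw [risingProd_succ, mul_assoc]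
    have hn := polyShift_ne_zero (risingProd_ne_zero n hv) 1
    refine (frac_denom_mul_le_red (by simpa using huv 0) hv (mul_ne_zero hn hP) ?_).trans ?_
    · refine IsCoprime.mul_right (isCoprime_shifts_risingProd huv _ _) ?_
      simpa using h 0 (Nat.succ_pos n)
    · rw [polyShift_mul, polyShift_polyShift, neg_add_cancel, polyShift_zero]
      refine red_le_red ((ih (polyShift_ne_zero hP _) fun i hi => ?_).trans_eq ?_)
      · rw [polyShift_polyShift]
        have := h (i + 1) (by omega)
        push_cast at this
        rwa [neg_add] at this
      · rw [polyShift_polyShift]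
        congr 2
        push_cast
        ring

theorem frac_fallingProd_mul_le_red (huv : ∀ n : ℤ, IsCoprime u (polyShift n v)) (hu : u ≠ 0)
    (hv : v ≠ 0) (n : ℕ) {P : F[X]} (hP : P ≠ 0)
    (h : ∀ i < n, IsCoprime v (polyShift (i + 1 : ℤ) P)) :
    frac (fallingProd n u * P) ≤ red u v (polyShift (n : ℤ) P) := by
  have hvu := isCoprime_shifts_symm huv
  induction n generalizing P with
  | zero => simpa [fallingProd] using frac_le_red P
  | succ n ih =>
    rw [fallingProd_succ, polyShift_mul, mul_assoc]
    have hn := polyShift_ne_zero (fallingProd_ne_zero n hu) (-1)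
    refine (frac_num_mul_le_red (by simpa using huv 0) hu hv (mul_ne_zero hn hP) ?_).trans ?_
    · rw [polyShift_mul, polyShift_polyShift, add_neg_cancel, polyShift_zero]
      exact IsCoprime.mul_right (isCoprime_fallingProd hvu _) (by simpa using h 0 (Nat.succ_pos n))
    · rw [polyShift_mul, polyShift_polyShift, add_neg_cancel, polyShift_zero]
      refine red_le_red ((ih (polyShift_ne_zero hP _) fun i hi => ?_).trans_eq ?_)
      · rw [polyShift_polyShift]
        have := h (i + 1) (by omega)
        push_cast at this
        exact this
      · rw [polyShift_polyShift]
        congr 2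

theorem irreducible_polyShift {p : F[X]} (hp : Irreducible p) (n : ℤ) :
    Irreducible (polyShift n p) := by
  rw [polyShift_eq_taylor]
  exact (MulEquiv.irreducible_iff (taylorEquiv (n : F))).mpr hp

/-- An orbit that meets both `u` and `v` would give a common factor of `u` and a shift of `v`. -/
theorem forall_isCoprime_or_forall_isCoprime (huv : ∀ n : ℤ, IsCoprime u (polyShift n v))
    {p : F[X]} (hp : Irreducible p) :
    (∀ n : ℤ, IsCoprime u (polyShift n p)) ∨ ∀ n : ℤ, IsCoprime v (polyShift n p) := by
  by_contra! h
  obtain ⟨⟨m, hm⟩, n, hn⟩ := h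
  rw [isCoprime_comm, (irreducible_polyShift hp _).coprime_iff_not_dvd, not_not] at hm hn
  have h1 := (huv (m - n)).of_isCoprime_of_dvd_left hm
  have h2 := polyShift_dvd_polyShift (m - n) hn
  rw [polyShift_polyShift, sub_add_cancel] at h2
  exact (irreducible_polyShift hp m).not_isUnit (h1.isUnit_of_dvd' dvd_rfl h2)

theorem red_one_le (P : F[X]) (hP : P ≠ 0) : red u v 1 ≤ red u v P :=
  red_le_red ((frac_mono hP (one_dvd P)).trans (frac_le_red P))

/-- Among the shifts of an irreducible polynomial there is one to which all others can be
reduced. -/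
theorem exists_forall_red_le [CharZero F] (hu : u ≠ 0) (hv : v ≠ 0)
    (huv : ∀ n : ℤ, IsCoprime u (polyShift n v)) {p : F[X]} (hp : Irreducible p) :
    ∃ n : ℤ, ∀ (k : ℕ) (m : ℤ), red u v (polyShift m p ^ k) ≤ red u v (polyShift n p ^ k) := by
  have hvu := isCoprime_shifts_symm huv
  -- Moving left is obstructed only by `u`. The extra factor `risingProd j v` is admitted into the
  -- denominator for free by `frac_mono`.
  have down : ∀ (k : ℕ) (m n : ℤ), n ≤ m →
      (∀ i : ℤ, n < i → i ≤ m → IsCoprime u (polyShift i p)) →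
      red u v (polyShift m p ^ k) ≤ red u v (polyShift n p ^ k) := by
    intro k m n hnm h
    obtain ⟨j, rfl⟩ : ∃ j : ℕ, m = n + j := ⟨(m - n).toNat, by omega⟩
    have hP := pow_ne_zero k (polyShift_ne_zero hp.ne_zero (n + j))
    refine red_le_red ((frac_mono (mul_ne_zero (risingProd_ne_zero j hv) hP)
      (dvd_mul_left _ _)).trans ((frac_risingProd_mul_le_red huv hv j hP fun i hi => ?_).trans_eq ?_))
    · rw [polyShift_pow, polyShift_polyShift]
      exact (h _ (by omega) (by omega)).pow_right
    · rw [polyShift_pow, polyShift_polyShift]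
      congr 3
      ring
  -- Moving right is obstructed only by `v`.
  have up : ∀ (k : ℕ) (m n : ℤ), m ≤ n →
      (∀ i : ℤ, m < i → i ≤ n → IsCoprime v (polyShift i p)) →
      red u v (polyShift m p ^ k) ≤ red u v (polyShift n p ^ k) := by
    intro k m n hnm h
    obtain ⟨j, rfl⟩ : ∃ j : ℕ, n = j + m := ⟨(n - m).toNat, by omega⟩
    have hP := pow_ne_zero k (polyShift_ne_zero hp.ne_zero m)
    refine red_le_red ((frac_mono (mul_ne_zero (fallingProd_ne_zero j hu) hP)
      (dvd_mul_left _ _)).trans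
      ((frac_fallingProd_mul_le_red huv hu hv j hP fun i hi => ?_).trans_eq ?_))
    · rw [polyShift_pow, polyShift_polyShift]
      exact (h _ (by omega) (by omega)).pow_right
    · rw [polyShift_pow, polyShift_polyShift]
  rcases forall_isCoprime_or_forall_isCoprime huv hp with h | h
  · obtain ⟨N, hN⟩ := exists_forall_isCoprime_polyShift hp.ne_zero hv
    -- The orbit misses `u`, so leftward moves are always possible. To the left of `-N` it also
    -- misses `v`, so the shifts there can be moved right up to `-N`.
    refine ⟨-N, fun k m => ?_⟩
    rcases le_total (-(N : ℤ)) m with hm | hm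
    · exact down k m _ hm fun i _ _ => h i
    · refine up k m _ hm fun i _ hi => (hN i ?_).symm
      rw [Int.abs_eq_natAbs]
      omega
  · obtain ⟨N, hN⟩ := exists_forall_isCoprime_polyShift hp.ne_zero hu
    refine ⟨N, fun k m => ?_⟩
    rcases le_total m (N : ℤ) with hm | hm
    · exact up k m _ hm fun i _ _ => h i
    · refine down k m _ hm fun i hi _ => (hN i ?_).symm
      rw [Int.abs_eq_natAbs]
      omega

/-! ### Rational functions that relate two shift-reduced kernels -/

/-- The relation between `σ(f) / f` and the two kernels, iterated `n` times with denominators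
cleared. -/
theorem risingProd_mul_eq {u v u' v' f₁ f₂ : F[X]} (hf₁ : f₁ ≠ 0) (hf₂ : f₂ ≠ 0)
    (h : u' * f₁ * polyShift 1 f₂ * v = polyShift 1 f₁ * u * v' * f₂) (n : ℕ) :
    risingProd n u' * f₁ * polyShift n f₂ * risingProd n v =
      polyShift n f₁ * risingProd n u * risingProd n v' * f₂ := by
  induction n with
  | zero => simp [risingProd]
  | succ n ih =>
    have ih' := congrArg (polyShift 1) ih
    simp only [polyShift_mul, polyShift_polyShift] at ih'
    have h1 := polyShift_ne_zero hf₁ 1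
    have h2 := polyShift_ne_zero hf₂ 1
    have hn : ((n + 1 : ℕ) : ℤ) = 1 + n := by push_cast; ring
    simp only [risingProd_succ, hn]
    refine mul_left_cancel₀ (mul_ne_zero h1 h2) ?_
    linear_combination ih' * (u' * f₁ * polyShift 1 f₂ * v) +
      polyShift (1 + n) f₁ * polyShift 1 (risingProd n u) * polyShift 1 (risingProd n v') *
        polyShift 1 f₂ * h

theorem isCoprime_risingProd_fallingProd {p q : F[X]}
    (h : ∀ n : ℤ, IsCoprime p (polyShift n q)) (m n : ℕ) :
    IsCoprime (risingProd m p) (fallingProd n q) := by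
  refine IsCoprime.prod_left fun i _ => ?_
  have := isCoprime_shifts_fallingProd h n (0 - i)
  simpa using (isCoprime_polyShift_comm (i : ℤ) 0).mpr this

/-- If `σ(f) / f` is the quotient of the shift-reduced rational functions `u' / v'` and `u / v`,
then the denominator of `f` is a product of a divisor of shifts of `u` to the right and a divisor
of shifts of `v` to the left. -/
theorem exists_denom_factorization [CharZero F] {u v u' v' : F[X]} (hv : v ≠ 0) (hv' : v' ≠ 0)
    (huv' : ∀ n : ℤ, IsCoprime u' (polyShift n v'))
    {f : RatFunc F}
    (h : algebraMap F[X] (RatFunc F) u' / algebraMap F[X] (RatFunc F) v' * f =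
      ratShift F f * (algebraMap F[X] (RatFunc F) u / algebraMap F[X] (RatFunc F) v)) :
    ∃ (f₁ d₁ d₂ : F[X]) (N : ℕ), d₁ ≠ 0 ∧ d₂ ≠ 0 ∧ d₁ ∣ fallingProd N u ∧ d₂ ∣ risingProd N v ∧
      f = algebraMap F[X] (RatFunc F) f₁ / algebraMap F[X] (RatFunc F) (d₁ * d₂) := by
  rcases eq_or_ne f 0 with rfl | hf
  · exact ⟨0, 1, 1, 0, one_ne_zero, one_ne_zero, one_dvd _, one_dvd _, by simp⟩
  have hf₁ : f.num ≠ 0 := RatFunc.num_ne_zero hf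
  have hf₂ : f.denom ≠ 0 := f.denom_ne_zero
  have hcop := f.isCoprime_num_denom
  have hfeq := f.num_div_denom
  -- `N` exceeds the dispersion of the denominator, which is thus coprime to its own shifts by `N`
  -- and `-N`. Iterating `N` times and cancelling then confines it to products of shifts of the
  -- kernels.
  obtain ⟨N, hN⟩ := exists_forall_isCoprime_polyShift hf₂ hf₂
  have key : u' * f.num * polyShift 1 f.denom * v = polyShift 1 f.num * u * v' * f.denom := by
    have h1 := RatFunc.algebraMap_ne_zero hv
    have h2 := RatFunc.algebraMap_ne_zero hv'
    have h3 := RatFunc.algebraMap_ne_zero hf₂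
    have h4 := RatFunc.algebraMap_ne_zero (polyShift_ne_zero hf₂ 1)
    rw [← hfeq, map_div₀, ratShift_algebraMap, ratShift_algebraMap] at h
    field_simp at h
    apply RatFunc.algebraMap_injective F
    simp only [map_mul]
    linear_combination h
  have e1 := risingProd_mul_eq hf₁ hf₂ key N
  have e2 := congrArg (polyShift (-(N : ℤ))) e1
  simp only [polyShift_mul, polyShift_polyShift, neg_add_cancel, polyShift_zero,
    ← polyShift_fallingProd] at e2
  have c1 : IsCoprime f.denom (polyShift N f.denom) := (hN N (by simp)).symm
  have c2 : IsCoprime f.denom (polyShift (-(N : ℤ)) f.denom) := (hN (-N) (by simp)).symm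
  have r1 : f.denom ∣ risingProd N u' * risingProd N v := by
    refine (hcop.symm.mul_right c1).dvd_of_dvd_mul_left (Dvd.intro_left
      (polyShift N f.num * risingProd N u * risingProd N v') ?_)
    linear_combination -e1
  have r2 : f.denom ∣ fallingProd N u * fallingProd N v' := by
    refine (hcop.symm.mul_right c2).dvd_of_dvd_mul_left (Dvd.intro_left
      (fallingProd N u' * polyShift (-N) f.num * fallingProd N v) ?_)
    linear_combination e2
  obtain ⟨d₁, d₂, h1, h2, h3⟩ := exists_dvd_and_dvd_of_dvd_mul r2
  have h0 : d₁ * d₂ ≠ 0 := h3 ▸ hf₂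
  refine ⟨f.num, d₁, d₂, N, left_ne_zero_of_mul h0, right_ne_zero_of_mul h0, h1, ?_,
    by rw [← h3, hfeq]⟩
  -- `d₂` divides shifts of `v'`, hence is coprime to all shifts of `u'`; the other divisibility
  -- `r1` places it in the shifts of `v`.
  refine IsCoprime.dvd_of_dvd_mul_left ?_ (((Dvd.intro_left d₁ h3.symm)).trans r1)
  exact (isCoprime_risingProd_fallingProd huv' N N).symm.of_isCoprime_of_dvd_left h2

/-- If the orbit of `p` misses `u`, then `d₁` splits off by partial fractions and reduces to
polynomials, while `d₂` disappears as `p ^ k` moves left. If it misses `v`, the roles are exchanged.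
The exponent `k` does not grow. -/
theorem exists_forall_mul_mem_red (hu : u ≠ 0) (hv : v ≠ 0)
    (huv : ∀ n : ℤ, IsCoprime u (polyShift n v)) {f₁ d₁ d₂ : F[X]} {N : ℕ} (hd₁ : d₁ ≠ 0)
    (hd₂ : d₂ ≠ 0) (h₁ : d₁ ∣ fallingProd N u) (h₂ : d₂ ∣ risingProd N v) {p : F[X]}
    (hp : Irreducible p) (k : ℕ) :
    ∃ m : ℤ, ∀ s ∈ frac (p ^ k), algebraMap F[X] (RatFunc F) f₁ /
      algebraMap F[X] (RatFunc F) (d₁ * d₂) * s ∈ red u v (polyShift m p ^ k) := by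
  have hvu := isCoprime_shifts_symm huv
  have hpk : p ^ k ≠ 0 := pow_ne_zero k hp.ne_zero
  suffices H : ∃ m : ℤ, frac (d₁ * d₂ * p ^ k) ≤ red u v (polyShift m p ^ k) by
    obtain ⟨m, hm⟩ := H
    refine ⟨m, ?_⟩
    rintro _ ⟨A, rfl⟩
    refine hm ⟨f₁ * A, ?_⟩
    simp only [divMap_apply, map_mul]
    rw [div_mul_div_comm]
  have hc : IsCoprime d₂ d₁ := by
    have := isCoprime_risingProd_fallingProd hvu N N
    exact (this.of_isCoprime_of_dvd_left h₂).of_isCoprime_of_dvd_right h₁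
  have hone : ∀ m : ℤ, red u v 1 ≤ red u v (polyShift m p ^ k) := fun m =>
    red_one_le _ (pow_ne_zero k (polyShift_ne_zero hp.ne_zero m))
  have hone₁ : frac d₁ ≤ red u v 1 := by
    have := frac_fallingProd_mul_le_red huv hu hv N (P := 1) one_ne_zero fun i _ => by
      rw [polyShift_one]; exact isCoprime_one_right
    rw [mul_one, polyShift_one] at this
    exact (frac_mono (fallingProd_ne_zero N hu) h₁).trans this
  have hone₂ : frac d₂ ≤ red u v 1 := by
    have := frac_risingProd_mul_le_red huv hv N (P := 1) one_ne_zero fun i _ => by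
      rw [polyShift_one]; exact isCoprime_one_right
    rw [mul_one, polyShift_one] at this
    exact (frac_mono (risingProd_ne_zero N hv) h₂).trans this
  rcases forall_isCoprime_or_forall_isCoprime huv hp with h | h
  · refine ⟨-N, ?_⟩
    have hd : IsCoprime d₁ (p ^ k) := by
      refine IsCoprime.pow_right (IsCoprime.of_isCoprime_of_dvd_left ?_ h₁)
      exact (isCoprime_fallingProd (isCoprime_shifts_symm h) N).symm
    rw [mul_assoc]
    refine (frac_mul_le hd₁ (mul_ne_zero hd₂ hpk) (hc.symm.mul_right hd)).trans (sup_le ?_ ?_)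
    · exact hone₁.trans (hone _)
    · have := frac_risingProd_mul_le_red huv hv N hpk fun i _ => by
        rw [polyShift_pow]; exact (h _).pow_right
      rw [polyShift_pow] at this
      exact (frac_mono (mul_ne_zero (risingProd_ne_zero N hv) hpk)
        (mul_dvd_mul_right h₂ _)).trans this
  · refine ⟨N, ?_⟩
    have hd : IsCoprime d₂ (p ^ k) := by
      refine IsCoprime.pow_right (IsCoprime.of_isCoprime_of_dvd_left ?_ h₂)
      exact (isCoprime_risingProd (isCoprime_shifts_symm h) N).symm
    rw [mul_comm d₁, mul_assoc]
    refine (frac_mul_le hd₂ (mul_ne_zero hd₁ hpk) (hc.mul_right hd)).trans (sup_le ?_ ?_)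
    · exact hone₂.trans (hone _)
    · have := frac_fallingProd_mul_le_red huv hu hv N hpk fun i _ => by
        rw [polyShift_pow]; exact (h _).pow_right
      rw [polyShift_pow] at this
      exact (frac_mono (mul_ne_zero (fallingProd_ne_zero N hu) hpk)
        (mul_dvd_mul_right h₁ _)).trans this

/-! ### The codimension of the image of the map for polynomial reduction -/

/-- The map `phi` as a linear map. -/
noncomputable def phiLin (u v : F[X]) : F[X] →ₗ[F] F[X] where
  toFun := phi u v
  map_add' p q := by simp only [phi, polyShift, add_comp]; ring
  map_smul' c p := by
    simp only [phi, polyShift, smul_comp, RingHom.id_apply, smul_sub, mul_smul_comm]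

theorem phiLin_apply (p : F[X]) : phiLin u v p = u * polyShift 1 p - v * p := rfl

theorem natDegree_risingProd (n : ℕ) (p : F[X]) : (risingProd n p).natDegree = n * p.natDegree := by
  rcases eq_or_ne p 0 with rfl | hp
  · rcases n with _ | n
    · simp [risingProd]
    · simp [risingProd_succ]
  rw [risingProd, natDegree_prod _ _ fun i _ => polyShift_ne_zero hp _]
  simp [natDegree_polyShift]

/-- Iterating `u σ(p) = v p` shows that arbitrarily long rising products of `u` divide `p`, and
those of `v` divide shifts of `p`. Degrees force `u` and `v` to be constant, and leading
coefficients force `u = v`. -/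
theorem phiLin_injective (huv : ∀ n : ℤ, IsCoprime u (polyShift n v))
    (hne : u ≠ v) : Function.Injective (phiLin u v) := by
  rw [← LinearMap.ker_eq_bot, LinearMap.ker_eq_bot']
  intro p hp
  by_contra hp0
  rw [phiLin_apply, sub_eq_zero] at hp
  have key : ∀ n : ℕ, risingProd n u * polyShift n p = risingProd n v * p := by
    intro n
    induction n with
    | zero => simp [risingProd]
    | succ n ih =>
      have ih' := congrArg (polyShift 1) ih
      simp only [polyShift_mul, polyShift_polyShift] at ih'
      have hn : ((n + 1 : ℕ) : ℤ) = 1 + n := by push_cast; ring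
      rw [risingProd_succ, risingProd_succ, hn]
      linear_combination u * ih' + polyShift 1 (risingProd n v) * hp
  have hcop : ∀ n : ℕ, IsCoprime (risingProd n u) (risingProd n v) := by
    intro n
    rw [← polyShift_fallingProd n v]
    refine IsCoprime.prod_left fun i _ => (isCoprime_polyShift_comm _ _).mpr ?_
    exact isCoprime_shifts_fallingProd huv _ _
  have hzero : ∀ d : ℕ, (p.natDegree + 1) * d ≤ p.natDegree → d = 0 := by
    intro d h
    by_contra hd
    have := Nat.le_mul_of_pos_right (p.natDegree + 1) (Nat.pos_of_ne_zero hd)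
    omega
  have hu0 : u.natDegree = 0 := by
    refine hzero _ ?_
    rw [← natDegree_risingProd]
    refine natDegree_le_of_dvd ((hcop _).dvd_of_dvd_mul_left ?_) hp0
    exact Dvd.intro _ (key _)
  have hv0 : v.natDegree = 0 := by
    refine hzero _ ?_
    have hs := natDegree_polyShift (p.natDegree + 1 : ℕ) p
    rw [← natDegree_risingProd]
    refine le_of_le_of_eq ?_ hs
    refine natDegree_le_of_dvd ((hcop _).symm.dvd_of_dvd_mul_left ?_) (polyShift_ne_zero hp0 _)
    exact Dvd.intro _ (key _).symm
  have hlc := congrArg leadingCoeff hp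
  rw [leadingCoeff_mul, leadingCoeff_mul, polyShift_eq_taylor, leadingCoeff_taylor] at hlc
  have hlc' := mul_right_cancel₀ (leadingCoeff_ne_zero.mpr hp0) hlc
  rw [leadingCoeff, leadingCoeff, hu0, hv0] at hlc'
  apply hne
  rw [eq_C_of_natDegree_eq_zero hu0, eq_C_of_natDegree_eq_zero hv0, hlc']

theorem eq_C_of_polyShift_eq [CharZero F] {n : ℤ} (hn : n ≠ 0) {p : F[X]}
    (h : polyShift n p = p) : p = C (p.eval 0) := by
  have h1 : ∀ i : ℕ, p.eval (i * (n : F)) = p.eval 0 := by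
    intro i
    induction i with
    | zero => simp
    | succ i ih =>
      rw [← ih]
      conv_rhs => rw [← h, polyShift_eq_taylor, taylor_eval]
      push_cast
      ring_nf
  have hinj : Function.Injective fun i : ℕ => (i : F) * (n : F) :=
    (mul_left_injective₀ (Int.cast_ne_zero.mpr hn)).comp Nat.cast_injective
  refine eq_of_infinite_eval_eq _ _ ((Set.infinite_range_of_injective hinj).mono ?_)
  rintro _ ⟨i, rfl⟩
  simp [h1]

theorem natDegree_polyShift_sub_lt {p : F[X]} (n : ℤ) (hp : p.natDegree ≠ 0) :
    (polyShift n p - p).natDegree < p.natDegree := by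
  have hp0 : p ≠ 0 := by
    rintro rfl
    simp at hp
  rcases eq_or_ne (polyShift n p - p) 0 with h | h
  · rw [h, natDegree_zero]
    omega
  · have := degree_sub_lt_left (p := polyShift n p) (q := p)
      (by rw [polyShift_eq_taylor, degree_taylor]) (polyShift_ne_zero hp0 _)
      (by rw [polyShift_eq_taylor, leadingCoeff_taylor])
    rw [← natDegree_polyShift n p]
    exact natDegree_lt_natDegree h this

theorem natDegree_phiLin_le (p : F[X]) :
    ((phiLin u v p).natDegree : ℤ) ≤ max 0 (p.natDegree + kernelBound u v) := by
  rw [phiLin_apply, kernelBound]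
  split_ifs with h
  -- Rewritten through `σ(p) - p`, whose degree drops, so that the cancellation recorded by the
  -- bracket becomes visible.
  · have e : u * polyShift 1 p - v * p = u * (polyShift 1 p - p) - (v - u) * p := by ring
    have h1 : ((v - u) * p).natDegree ≤ (v - u).natDegree + p.natDegree := natDegree_mul_le
    have h2 : (u * (polyShift 1 p - p)).natDegree ≤ u.natDegree + p.natDegree - 1 := by
      rcases Nat.eq_zero_or_pos p.natDegree with h0 | h0
      · have : polyShift 1 p - p = 0 := by
          rw [eq_C_of_natDegree_eq_zero h0]
          simp [polyShift]
        simp [this]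
      · have h3 := natDegree_polyShift_sub_lt 1 h0.ne'
        have h4 := natDegree_mul_le (p := u) (q := polyShift 1 p - p)
        omega
    have h5 := natDegree_sub_le (u * (polyShift 1 p - p)) ((v - u) * p)
    rw [e]
    omega
  · have h1 := natDegree_sub_le (u * polyShift 1 p) (v * p)
    have h2 := natDegree_mul_le (p := u) (q := polyShift 1 p)
    have h3 := natDegree_mul_le (p := v) (q := p)
    rw [natDegree_polyShift] at h2
    omega

theorem kernelBound_nonneg : 0 ≤ kernelBound u v := by
  rw [kernelBound]
  split_ifs with h <;> omega

theorem finrank_degreeLT (n : ℕ) : Module.finrank F (degreeLT F n) = n := by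
  rw [(degreeLTEquiv F n).finrank_eq, Module.finrank_fin_fun]

instance finite_degreeLT (n : ℕ) : Module.Finite F (degreeLT F n) :=
  Module.Finite.equiv (degreeLTEquiv F n).symm

theorem mem_degreeLT_of_natDegree_lt {p : F[X]} {n : ℕ} (h : p.natDegree < n) :
    p ∈ degreeLT F n := by
  rw [mem_degreeLT]
  exact degree_le_natDegree.trans_lt (by exact_mod_cast h)

theorem natDegree_lt_of_mem_degreeLT {p : F[X]} {n : ℕ} (hp : p ≠ 0) (h : p ∈ degreeLT F n) :
    p.natDegree < n := by
  rwa [mem_degreeLT, degree_eq_natDegree hp, Nat.cast_lt] at h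

theorem exists_submodule_range_phiLin [CharZero F] (hu : u ≠ 0) (hv : v ≠ 0)
    (huv : ∀ n : ℤ, IsCoprime u (polyShift n v)) (n : ℕ) :
    ∃ U : Submodule F F[X], U ≤ degreeLT F (n + (kernelBound u v).toNat) ∧
      U ≤ LinearMap.range (phiLin u v) ∧ n ≤ Module.finrank F U := by
  have hb := kernelBound_nonneg (u := u) (v := v)
  rcases eq_or_ne u v with rfl | hne
  · have hunit : IsUnit u := isCoprime_self.mp (by simpa using huv 0)
    have hu0 : u.natDegree = 0 := natDegree_eq_zero_of_isUnit hunit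
    -- For `u = v` the kernel consists of the constants and degrees drop by at least one: the extra
    -- dimension in the source compensates for the kernel.
    refine ⟨LinearMap.range ((phiLin u u).domRestrict (degreeLT F (n + 1))), ?_, ?_, ?_⟩
    · rintro _ ⟨⟨p, hp⟩, rfl⟩
      rw [LinearMap.domRestrict_apply]
      rcases Nat.eq_zero_or_pos p.natDegree with h0 | h0
      · have : phiLin u u p = 0 := by
          rw [phiLin_apply, eq_C_of_natDegree_eq_zero h0]
          simp [polyShift]
        rw [this]
        exact Submodule.zero_mem _
      · have hp' := natDegree_lt_of_mem_degreeLT (fun h => by simp [h] at h0) hp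
        have h3 := natDegree_polyShift_sub_lt 1 h0.ne'
        have h4 := natDegree_mul_le (p := u) (q := polyShift 1 p - p)
        refine mem_degreeLT_of_natDegree_lt ?_
        change (u * polyShift 1 p - u * p).natDegree < _
        rw [← mul_sub]
        omega
    · rintro _ ⟨p, rfl⟩
      exact ⟨p, rfl⟩
    · have h1 := ((phiLin u u).domRestrict (degreeLT F (n + 1))).finrank_range_add_finrank_ker
      rw [finrank_degreeLT] at h1
      have hone : (1 : F[X]) ∈ degreeLT F (n + 1) :=
        mem_degreeLT_of_natDegree_lt (by simp)
      have h2 : Module.finrank F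
          (LinearMap.ker ((phiLin u u).domRestrict (degreeLT F (n + 1)))) ≤ 1 := by
        refine finrank_le_one ⟨⟨1, hone⟩, ?_⟩ ?_
        · rw [LinearMap.mem_ker, LinearMap.domRestrict_apply, phiLin_apply, polyShift_one, sub_self]
        · rintro ⟨⟨p, hp⟩, hk⟩
          have hk' : u * polyShift 1 p - u * p = 0 := hk
          rw [← mul_sub] at hk'
          have := sub_eq_zero.mp ((mul_eq_zero.mp hk').resolve_left hu)
          refine ⟨p.eval 0, Subtype.ext (Subtype.ext ?_)⟩
          change p.eval 0 • (1 : F[X]) = p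
          rw [smul_eq_C_mul, mul_one, ← eq_C_of_polyShift_eq one_ne_zero this]
      omega
  · refine ⟨(degreeLT F n).map (phiLin u v), ?_, LinearMap.map_le_range, ?_⟩
    · rintro _ ⟨p, hp, rfl⟩
      rcases eq_or_ne p 0 with rfl | hp0
      · rw [map_zero]
        exact Submodule.zero_mem _
      · have h1 := natDegree_lt_of_mem_degreeLT hp0 hp
        have h2 := natDegree_phiLin_le (u := u) (v := v) p
        exact mem_degreeLT_of_natDegree_lt (by omega)
    · rw [(Submodule.equivMapOfInjective _ (phiLin_injective huv hne) _).symm.finrank_eq,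
        finrank_degreeLT]

/-- Finitely many classes have representatives of degree less than `n`. In the space of polynomials
of degree less than `n + m`, the image of `phi` has dimension at least `n`, so at most `m`
independent classes remain. -/
theorem rank_quotient_range_phiLin_le [CharZero F] (hu : u ≠ 0) (hv : v ≠ 0)
    (huv : ∀ n : ℤ, IsCoprime u (polyShift n v)) :
    Module.rank F (F[X] ⧸ LinearMap.range (phiLin u v)) ≤ (kernelBound u v).toNat := by
  refine rank_le fun s hs => ?_
  set m := (kernelBound u v).toNat
  let π := (LinearMap.range (phiLin u v)).mkQ
  choose r hr using fun x => (LinearMap.range (phiLin u v)).mkQ_surjective x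
  let n := s.sup (fun x => (r x).natDegree) + 1
  obtain ⟨U, hU1, hU2, hU3⟩ := exists_submodule_range_phiLin hu hv huv n
  let g := π.domRestrict (degreeLT F (n + m))
  have h1 := g.finrank_range_add_finrank_ker
  rw [finrank_degreeLT] at h1
  have h2 : Module.finrank F U ≤ Module.finrank F (LinearMap.ker g) := by
    let j : U →ₗ[F] LinearMap.ker g := (Submodule.inclusion hU1).codRestrict _ fun x => by
      rw [LinearMap.mem_ker]
      exact (Submodule.Quotient.mk_eq_zero _).mpr (hU2 x.2)
    refine LinearMap.finrank_le_finrank_of_injective (f := j) ?_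
    intro x y hxy
    exact Submodule.inclusion_injective hU1 (congrArg Subtype.val hxy)
  have hmem : ∀ x : s, (x : F[X] ⧸ LinearMap.range (phiLin u v)) ∈ LinearMap.range g := by
    intro x
    have hx : (r x).natDegree ≤ s.sup (fun x => (r x).natDegree) :=
      Finset.le_sup (f := fun x => (r x).natDegree) x.2
    exact ⟨⟨r x, mem_degreeLT_of_natDegree_lt (by omega)⟩, hr x⟩
  have h3 : LinearIndependent F fun x : s => (⟨x, hmem x⟩ : LinearMap.range g) :=
    LinearIndependent.of_comp (LinearMap.range g).subtype hs
  have h4 := h3.fintype_card_le_finrank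
  rw [Fintype.card_coe] at h4
  omega

/-- Sufficiently many rational functions that can be reduced to the given denominators satisfy
a linear relation modulo the image of `s ↦ (u / v) σ(s) - s`. -/
theorem exists_relation [CharZero F] (hu : u ≠ 0) (hv : v ≠ 0)
    (huv : ∀ n : ℤ, IsCoprime u (polyShift n v)) {ι : Type*} [Fintype ι] (P : ι → F[X])
    (hP : ∀ i, P i ≠ 0) {n : ℕ} (hn : kernelBound u v + ∑ i, ((P i).natDegree : ℤ) ≤ n)
    (s : Fin (n + 1) → RatFunc F) (hs : ∀ i, s i ∈ red u v 1 ⊔ ⨆ i, red u v (P i)) :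
    ∃ e : Fin (n + 1) → F, e ≠ 0 ∧ ∑ i, e i • s i ∈ LinearMap.range
      (qdiff (algebraMap F[X] (RatFunc F) u / algebraMap F[X] (RatFunc F) v)) := by
  classical
  have hv' := RatFunc.algebraMap_ne_zero hv
  set I := LinearMap.range
    (qdiff (algebraMap F[X] (RatFunc F) u / algebraMap F[X] (RatFunc F) v)) with hI
  have hrank := rank_quotient_range_phiLin_le hu hv huv
  have : Module.Finite F (F[X] ⧸ LinearMap.range (phiLin u v)) :=
    Module.rank_lt_aleph0_iff.mp (hrank.trans_lt (Cardinal.natCast_lt_aleph0))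
  have hfin := Module.finrank_le_of_rank_le hrank
  -- The fraction `phi(p) / v` equals `K σ(p) - p`.
  have hker : LinearMap.range (phiLin u v) ≤ LinearMap.ker (I.mkQ ∘ₗ divMap v) := by
    rintro _ ⟨p, rfl⟩
    rw [LinearMap.mem_ker, LinearMap.comp_apply, Submodule.mkQ_apply,
      Submodule.Quotient.mk_eq_zero]
    refine ⟨algebraMap F[X] (RatFunc F) p, ?_⟩
    rw [qdiff_apply, divMap_apply, phiLin_apply, ratShift_algebraMap, map_sub, map_mul, map_mul]
    field_simp
  let Ψ₂ : (F[X] ⧸ LinearMap.range (phiLin u v)) →ₗ[F] (RatFunc F ⧸ I) :=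
    (LinearMap.range (phiLin u v)).liftQ (I.mkQ ∘ₗ divMap v) hker
  let Ψ₁ : (∀ i, degreeLT F (P i).natDegree) →ₗ[F] (RatFunc F ⧸ I) :=
    LinearMap.lsum F (fun i => degreeLT F (P i).natDegree) F
      fun i => I.mkQ ∘ₗ divMap (P i) ∘ₗ (degreeLT F (P i).natDegree).subtype
  let Ψ := Ψ₁.coprod Ψ₂
  -- Polynomials are covered by the fractions over `v` and need no dimension of their own.
  have hpoly : ∀ A : F[X], I.mkQ (algebraMap F[X] (RatFunc F) A) ∈ LinearMap.range Ψ := by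
    intro A
    refine ⟨(0, Submodule.Quotient.mk (A * v)), ?_⟩
    have : divMap v (A * v) = algebraMap F[X] (RatFunc F) A := by
      rw [divMap_apply, map_mul]
      field_simp
    simp [Ψ, Ψ₂, this]
  have hIle : I ≤ (LinearMap.range Ψ).comap I.mkQ := by
    intro x hx
    rw [Submodule.mem_comap, Submodule.mkQ_apply, (Submodule.Quotient.mk_eq_zero _).mpr hx]
    exact Submodule.zero_mem _
  have hle : red u v 1 ⊔ ⨆ i, red u v (P i) ≤ (LinearMap.range Ψ).comap I.mkQ := by
    refine sup_le (sup_le ?_ hIle) (iSup_le fun i => sup_le ?_ hIle)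
    · rintro _ ⟨A, rfl⟩
      rw [divMap_apply, map_one, div_one]
      exact hpoly A
    · rintro _ ⟨A, rfl⟩
      have hi := RatFunc.algebraMap_ne_zero (hP i)
      have hsplit : divMap (P i) A = divMap (P i) (A % P i) +
          algebraMap F[X] (RatFunc F) (A / P i) := by
        conv_lhs => rw [← EuclideanDomain.mod_add_div A (P i)]
        rw [divMap_apply, divMap_apply, map_add, map_mul]
        field_simp
      rw [hsplit]
      refine Submodule.add_mem _ ?_ (hpoly _)
      have hmem : A % P i ∈ degreeLT F (P i).natDegree := by
        rw [mem_degreeLT, ← degree_eq_natDegree (hP i)]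
        exact EuclideanDomain.mod_lt A (hP i)
      refine ⟨(Pi.single i ⟨A % P i, hmem⟩, 0), ?_⟩
      rw [LinearMap.coprod_apply, map_zero, add_zero]
      exact LinearMap.lsum_piSingle ..
  choose x hx using fun i => hle (hs i)
  have hcard : Module.finrank F ((∀ i, degreeLT F (P i).natDegree) ×
      (F[X] ⧸ LinearMap.range (phiLin u v))) < Fintype.card (Fin (n + 1)) := by
    rw [Module.finrank_prod, Module.finrank_pi_fintype, Fintype.card_fin]
    simp only [finrank_degreeLT]
    have := kernelBound_nonneg (u := u) (v := v)
    zify at hfin ⊢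
    rw [Int.toNat_of_nonneg this] at hfin
    linarith
  obtain ⟨e, he, i, hi⟩ := Fintype.not_linearIndependent_iff.mp
    fun h : LinearIndependent F x => absurd h.fintype_card_le_finrank (not_le.mpr hcard)
  refine ⟨e, fun h => hi (congrFun h i), ?_⟩
  rw [← Submodule.Quotient.mk_eq_zero, ← Submodule.mkQ_apply, map_sum]
  have := congrArg Ψ he
  rw [map_sum, map_zero] at this
  rw [← this]
  refine Finset.sum_congr rfl fun i _ => ?_
  rw [map_smul, map_smul, hx]

end Univariate

section Bivariate

variable {k : Type*} [Field k]

/-! ### Integer-linear polynomials -/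

theorem linSub_eq_comp (P : k[X]) (l m : ℤ) :
    linSub P l m = (P.map Polynomial.C).comp (Polynomial.C (m : k[X]) * X +
      Polynomial.C ((l : k[X]) * X)) := by
  rw [linSub, aeval_def, comp, eval₂_map, add_comm, map_mul]
  simp [IsScalarTower.algebraMap_eq k k[X] k[X][X], algebraMap_eq]

/-- The polynomial `P(l x + m y + i)`. -/
noncomputable def linShift (P : k[X]) (l m i : ℤ) : k[X][X] :=
  linSub (polyShift i P) l m

@[simp]
theorem linShift_zero (P : k[X]) (l m : ℤ) : linShift P l m 0 = linSub P l m := by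
  rw [linShift, polyShift_zero]

theorem linShift_polyShift (P : k[X]) (l m i j : ℤ) :
    linShift (polyShift j P) l m i = linShift P l m (i + j) := by
  rw [linShift, polyShift_polyShift, linShift]

variable (k) in
/-- The operator `σ_x^m σ_y^n` on `C[x,y]` as a ring homomorphism. -/
noncomputable def biShiftHom (m n : ℤ) : k[X][X] →+* k[X][X] :=
  (compRingHom (X + (n : k[X][X]))).comp
    (mapRingHom (compRingHom (X + Polynomial.C (m : k))))

theorem biShiftHom_apply (m n : ℤ) (p : k[X][X]) : biShiftHom k m n p = biShift m n p := rfl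

theorem biShift_C_X (m n : ℤ) :
    biShift m n (Polynomial.C X : k[X][X]) = Polynomial.C X + (m : k[X][X]) := by
  simp [biShift]

theorem biShift_X (m n : ℤ) : biShift m n (X : k[X][X]) = X + (n : k[X][X]) := by
  simp [biShift]

theorem biShift_C_C (m n : ℤ) (c : k) :
    biShift m n (Polynomial.C (Polynomial.C c) : k[X][X]) = Polynomial.C (Polynomial.C c) := by
  simp [biShift]

theorem biShift_biShift (m n m' n' : ℤ) (p : k[X][X]) :
    biShift m n (biShift m' n' p) = biShift (m + m') (n + n') p := by
  have : (biShiftHom k m n).comp (biShiftHom k m' n') = biShiftHom k (m + m') (n + n') := by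
    refine ringHom_ext (fun a => ?_) ?_
    · have : ((biShiftHom k m n).comp (biShiftHom k m' n')).comp Polynomial.C =
        (biShiftHom k (m + m') (n + n')).comp Polynomial.C := by
        refine ringHom_ext (fun c => ?_) ?_
        · simp [biShiftHom_apply, biShift_C_C]
        · simp only [RingHom.comp_apply, biShiftHom_apply, biShift_C_X]
          rw [← biShiftHom_apply, map_add, biShiftHom_apply, biShift_C_X, map_intCast]
          push_cast
          ring
      exact DFunLike.congr_fun this a
    · simp only [RingHom.comp_apply, biShiftHom_apply, biShift_X]
      rw [← biShiftHom_apply, map_add, biShiftHom_apply, biShift_X, map_intCast]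
      push_cast
      ring
  exact DFunLike.congr_fun this p

theorem biShift_zero (p : k[X][X]) : biShift 0 0 p = p := by
  have h : compRingHom (X + Polynomial.C ((0 : ℤ) : k)) = RingHom.id k[X] := by
    ext <;> simp
  rw [biShift, h, Polynomial.map_id]
  simp

theorem biShiftEquiv_symm {p q : k[X][X]} (h : BiShiftEquiv p q) : BiShiftEquiv q p := by
  obtain ⟨m, n, rfl⟩ := h
  exact ⟨-m, -n, by rw [biShift_biShift, neg_add_cancel, neg_add_cancel, biShift_zero]⟩

theorem biShiftEquiv_trans {p q r : k[X][X]} (h : BiShiftEquiv p q) (h' : BiShiftEquiv q r) :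
    BiShiftEquiv p r := by
  obtain ⟨m, n, rfl⟩ := h
  obtain ⟨m', n', rfl⟩ := h'
  exact ⟨_, _, biShift_biShift _ _ _ _ _⟩

theorem irreducible_biShift {p : k[X][X]} (hp : Irreducible p) (m n : ℤ) :
    Irreducible (biShift m n p) := by
  let e : k[X][X] ≃* k[X][X] :=
    { toFun := biShift m n
      invFun := biShift (-m) (-n)
      left_inv := fun p => by
        rw [biShift_biShift, neg_add_cancel, neg_add_cancel, biShift_zero]
      right_inv := fun p => by
        rw [biShift_biShift, add_neg_cancel, add_neg_cancel, biShift_zero]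
      map_mul' := map_mul (biShiftHom k m n) }
  exact (MulEquiv.irreducible_iff e).mpr hp

/-- A shift acts on the orbit through the single integer `a l + b m`. In particular `σ_y` adds `m`
and `σ_x` adds `l` to the index. -/
theorem biShift_linSub (a b : ℤ) (P : k[X]) (l m : ℤ) :
    biShift a b (linSub P l m) = linShift P l m (a * l + b * m) := by
  induction P using Polynomial.induction_on' with
  | add p q hp hq =>
    rw [linSub, map_add, ← biShiftHom_apply, map_add, biShiftHom_apply, biShiftHom_apply,
      ← linSub, ← linSub, hp, hq, linShift, linShift, linShift, linSub, linSub, linSub, ← map_add]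
    simp only [polyShift, add_comp]
  | monomial n c =>
    rw [← C_mul_X_pow_eq_monomial, linShift, polyShift]
    simp only [linSub, map_mul, map_pow, aeval_C, aeval_X, mul_comp, pow_comp, C_comp, X_comp,
      map_add, ← biShiftHom_apply, map_intCast]
    rw [IsScalarTower.algebraMap_apply k k[X] k[X][X]]
    simp only [algebraMap_eq, biShiftHom_apply, biShift_C_C, biShift_C_X, biShift_X]
    push_cast
    ring

theorem biShift_linShift (a b : ℤ) (P : k[X]) (l m i : ℤ) :
    biShift a b (linShift P l m i) = linShift P l m (i + a * l + b * m) := by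
  rw [linShift, biShift_linSub, linShift_polyShift]
  congr 1
  ring

theorem exists_biShift_linSub_eq {l m : ℤ} (h : IsCoprime l m) (P : k[X]) (i : ℤ) :
    ∃ a b : ℤ, biShift a b (linSub P l m) = linShift P l m i := by
  obtain ⟨a, b, hab⟩ := h
  refine ⟨i * a, i * b, ?_⟩
  rw [biShift_linSub]
  congr 1
  linear_combination i * hab

theorem irreducible_linShift {l m : ℤ} (h : IsCoprime l m) {P : k[X]}
    (hP : Irreducible (linSub P l m)) (i : ℤ) : Irreducible (linShift P l m i) := by
  obtain ⟨a, b, hab⟩ := exists_biShift_linSub_eq h P i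
  rw [← hab]
  exact irreducible_biShift hP a b

/-! ### Degrees and leading coefficients in `y` -/

section Degree

variable [CharZero k]

theorem natDegree_linSub (P : k[X]) (l : ℤ) {m : ℤ} (hm : m ≠ 0) :
    (linSub P l m).natDegree = P.natDegree := by
  rw [linSub_eq_comp, natDegree_comp, natDegree_linear (Int.cast_ne_zero.mpr hm), mul_one,
    natDegree_map_eq_of_injective C_injective]

theorem leadingCoeff_linSub (P : k[X]) (l : ℤ) {m : ℤ} (hm : m ≠ 0) :
    (linSub P l m).leadingCoeff = Polynomial.C (P.leadingCoeff * (m : k) ^ P.natDegree) := by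
  have hm' : (m : k[X]) ≠ 0 := Int.cast_ne_zero.mpr hm
  rw [linSub_eq_comp, leadingCoeff_comp (by rw [natDegree_linear hm']; exact one_ne_zero),
    leadingCoeff_linear hm', natDegree_map_eq_of_injective C_injective,
    leadingCoeff_map_of_injective C_injective]
  simp

theorem monic_linSub_iff {P : k[X]} {l m : ℤ} (hm : m ≠ 0) :
    (linSub P l m).leadingCoeff.Monic ↔ P.leadingCoeff * (m : k) ^ P.natDegree = 1 := by
  rw [leadingCoeff_linSub P l hm, Monic, leadingCoeff_C]

/-- The leading coefficient in `y` is a constant, so lexicographic monicity already means monic in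
`y`, and shifts preserve it. -/
theorem monic_linShift {P : k[X]} {l m : ℤ} (hm : m ≠ 0) (h : (linSub P l m).leadingCoeff.Monic)
    (i : ℤ) : (linShift P l m i).Monic := by
  rw [monic_linSub_iff hm] at h
  rw [Monic, linShift, leadingCoeff_linSub _ _ hm, natDegree_polyShift, polyShift_eq_taylor,
    leadingCoeff_taylor, h, map_one]

theorem linSub_injective (l : ℤ) {m : ℤ} (hm : m ≠ 0) :
    Function.Injective fun P : k[X] => linSub P l m := by
  intro P Q h
  have h1 : linSub (P - Q) l m = 0 := by
    simp only at h
    rw [linSub, map_sub, ← linSub, ← linSub, h, sub_self]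
  have h2 := leadingCoeff_linSub (P - Q) l hm
  rw [h1, leadingCoeff_zero, eq_comm, map_eq_zero_iff _ C_injective, mul_eq_zero] at h2
  have h3 : ((m : k) ^ (P - Q).natDegree) ≠ 0 := pow_ne_zero _ (Int.cast_ne_zero.mpr hm)
  exact sub_eq_zero.mp (leadingCoeff_eq_zero.mp (h2.resolve_right h3))

theorem linShift_injective {P : k[X]} {l m : ℤ} (hm : m ≠ 0) (hP : Irreducible (linSub P l m)) :
    Function.Injective (linShift P l m) := by
  intro i j hij
  by_contra hne
  have h1 : polyShift i P = polyShift j P := linSub_injective l hm hij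
  have h2 := congrArg (polyShift (-j)) h1
  rw [polyShift_polyShift, polyShift_polyShift, neg_add_cancel, polyShift_zero] at h2
  have h3 := eq_C_of_polyShift_eq (n := -j + i) (by omega) h2
  rw [h3] at hP
  have h4 : linSub (Polynomial.C (P.eval 0)) l m = Polynomial.C (Polynomial.C (P.eval 0)) := by
    rw [linSub, aeval_C, IsScalarTower.algebraMap_apply k k[X] k[X][X]]
    rfl
  rw [h4] at hP
  have h5 : P.eval 0 ≠ 0 := by
    intro h
    rw [h] at hP
    simp at hP
  refine hP.not_isUnit ((IsUnit.map Polynomial.C (IsUnit.map Polynomial.C h5.isUnit)))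

end Degree

/-! ### Passage to polynomials over the rational function field -/

theorem toRatPoly_injective : Function.Injective (toRatPoly (C := k)) :=
  map_injective _ (RatFunc.algebraMap_injective k)

theorem toRatPoly_apply (p : k[X][X]) :
    toRatPoly p = p.map (algebraMap k[X] (RatFunc k)) := rfl

theorem map_ratShift_toRatPoly (p : k[X][X]) :
    (toRatPoly p).map (ratShift k : RatFunc k →+* RatFunc k) = toRatPoly (biShift 1 0 p) := by
  rw [toRatPoly_apply, toRatPoly_apply, Polynomial.map_map, biShift, Int.cast_zero, add_zero,
    comp_X, Polynomial.map_map]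
  congr 1
  refine RingHom.ext fun r => ?_
  simp [ratShift_algebraMap, polyShift]

theorem polyShift_toRatPoly (n : ℤ) (p : k[X][X]) :
    polyShift n (toRatPoly p) = toRatPoly (biShift 0 n p) := by
  have h : (compRingHom (X + Polynomial.C ((0 : ℤ) : k))) = RingHom.id k[X] := by
    ext <;> simp
  rw [polyShift, biShift, h, Polynomial.map_id, toRatPoly_apply, toRatPoly_apply,
    Polynomial.map_comp]
  simp

theorem polyShift_toRatPoly_linShift (n : ℤ) (P : k[X]) (l m i : ℤ) :
    polyShift n (toRatPoly (linShift P l m i)) = toRatPoly (linShift P l m (i + n * m)) := by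
  rw [polyShift_toRatPoly, biShift_linShift, zero_mul, add_zero]

theorem map_ratShift_toRatPoly_linShift (P : k[X]) (l m i : ℤ) :
    (toRatPoly (linShift P l m i)).map (ratShift k : RatFunc k →+* RatFunc k) =
      toRatPoly (linShift P l m (i + l)) := by
  rw [map_ratShift_toRatPoly, biShift_linShift, zero_mul, add_zero, one_mul]

theorem irreducible_toRatPoly {p : k[X][X]} (hm : p.Monic) (hp : Irreducible p) :
    Irreducible (toRatPoly p) :=
  hm.irreducible_iff_irreducible_map_fraction_map.mp hp

theorem isCoprime_toRatPoly {p q : k[X][X]} (hpm : p.Monic) (hp : Irreducible p) (hqm : q.Monic)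
    (hq : Irreducible q) (hne : p ≠ q) : IsCoprime (toRatPoly p) (toRatPoly q) := by
  rw [(irreducible_toRatPoly hpm hp).coprime_iff_not_dvd]
  intro h
  have h1 := ((irreducible_toRatPoly hpm hp).associated_of_dvd (irreducible_toRatPoly hqm hq) h)
  exact hne (toRatPoly_injective (eq_of_monic_of_associated (hpm.map _) (hqm.map _) h1))

theorem xiPow_eq (P : k[X]) (l m : ℤ) (ξ : ℕ[X]) :
    xiPow P l m ξ = ∏ i ∈ ξ.support, linShift P l m i ^ ξ.coeff i := by
  refine Finset.prod_congr rfl fun i _ => ?_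
  rw [linShift, polyShift]
  simp

end Bivariate

section Bivariate

variable {k : Type*} [Field k]

/-! ### The action of the shifts on rational functions -/

theorem shiftX_algebraMap (p : (RatFunc k)[X]) :
    shiftX k (algebraMap (RatFunc k)[X] (RatFunc (RatFunc k)) p) =
      algebraMap (RatFunc k)[X] (RatFunc (RatFunc k))
        (p.map (ratShift k : RatFunc k →+* RatFunc k)) := by
  exact IsFractionRing.ringEquivOfRingEquiv_algebraMap _ _

theorem shiftX_smul (c : RatFunc k) (s : RatFunc (RatFunc k)) :
    shiftX k (c • s) = ratShift k c • shiftX k s := by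
  rw [RatFunc.smul_eq_C_mul, map_mul, ← RatFunc.algebraMap_C, shiftX_algebraMap,
    RatFunc.smul_eq_C_mul, ← RatFunc.algebraMap_C, Polynomial.map_C]
  rfl

/-- The semilinear operator `s ↦ f σ_x(s)` on `C(x,y)`. -/
noncomputable def twistX (f : RatFunc (RatFunc k)) :
    RatFunc (RatFunc k) →ₛₗ[(ratShift k : RatFunc k →+* RatFunc k)] RatFunc (RatFunc k) where
  toFun s := f * shiftX k s
  map_add' s t := by rw [map_add, mul_add]
  map_smul' c s := by
    rw [shiftX_smul, mul_smul_comm]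
    rfl

theorem twistX_apply (f s : RatFunc (RatFunc k)) : twistX f s = f * shiftX k s := rfl

theorem map_polyShift {F : Type*} [Field F] (φ : F →+* F) (n : ℤ) (p : F[X]) :
    (polyShift n p).map φ = polyShift n (p.map φ) := by
  simp [polyShift, Polynomial.map_comp]

theorem shiftX_shiftY (s : RatFunc (RatFunc k)) :
    shiftX k (shiftY k s) = shiftY k (shiftX k s) := by
  rw [← s.num_div_denom, shiftY]
  simp only [map_div₀, ratShift_algebraMap, shiftX_algebraMap, map_polyShift]

theorem isCoprime_map_shifts {F : Type*} [Field F] (φ : F →+* F) {u v : F[X]}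
    (huv : ∀ n : ℤ, IsCoprime u (polyShift n v)) (n : ℤ) :
    IsCoprime (u.map φ) (polyShift n (v.map φ)) := by
  rw [← map_polyShift]
  exact (huv n).map (mapRingHom φ)

variable [CharZero k]

/-- The residual space of a decomposition: the rational functions that are reduced to one
denominator for each residue class of shifts of each factor. -/
theorem exists_invariant_residual_space {u v : (RatFunc k)[X]} (hu : u ≠ 0) (hv : v ≠ 0)
    (huv : ∀ n : ℤ, IsCoprime u (polyShift n v)) {f : RatFunc (RatFunc k)}
    (hf : shiftX k (algebraMap _ (RatFunc (RatFunc k)) u / algebraMap _ (RatFunc (RatFunc k)) v) *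
      f = shiftY k f *
        (algebraMap _ (RatFunc (RatFunc k)) u / algebraMap _ (RatFunc (RatFunc k)) v))
    {t : ℕ} (P : Fin t → k[X]) (l m : Fin t → ℤ) (M : Fin t → ℕ) (hm : ∀ j, 0 < m j)
    (hirr : ∀ j i, Irreducible (toRatPoly (linShift (P j) (l j) (m j) i))) :
    ∃ B : (Σ j : Fin t, Fin (m j).toNat) → (RatFunc k)[X], (∀ z, B z ≠ 0) ∧
      (∀ z, (B z).natDegree = M z.1 * (P z.1).natDegree) ∧
      (∀ s ∈ red u v 1 ⊔ ⨆ z, red u v (B z), twistX f s ∈ red u v 1 ⊔ ⨆ z, red u v (B z)) ∧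
      ∀ j i, ∀ e ≤ M j, frac (toRatPoly (linShift (P j) (l j) (m j) i) ^ e) ≤
        red u v 1 ⊔ ⨆ z, red u v (B z) := by
  let p : Fin t → ℤ → (RatFunc k)[X] := fun j i => toRatPoly (linShift (P j) (l j) (m j) i)
  have hpdef : ∀ j i, toRatPoly (linShift (P j) (l j) (m j) i) = p j i := fun _ _ => rfl
  simp only [hpdef] at hirr ⊢
  have hshift : ∀ n j i, polyShift n (p j i) = p j (i + n * m j) := fun n j i =>
    polyShift_toRatPoly_linShift n _ _ _ i
  -- One orbit for each `j` and each residue modulo `m j`; `n z` is the position to which that orbit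
  -- is moved.
  choose n hn using fun z : Σ j : Fin t, Fin (m j).toNat =>
    exists_forall_red_le hu hv huv (hirr z.1 z.2)
  let B : (Σ j : Fin t, Fin (m j).toNat) → (RatFunc k)[X] := fun z =>
    polyShift (n z) (p z.1 z.2) ^ M z.1
  have hB : ∀ z, B z ≠ 0 := fun z => pow_ne_zero _ (polyShift_ne_zero (hirr _ _).ne_zero _)
  set S := red u v 1 ⊔ ⨆ z, red u v (B z) with hS
  have hmem : ∀ j i, ∀ e ≤ M j, red u v (p j i ^ e) ≤ S := by
    intro j i e he
    have h0 := hm j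
    have h1 := Int.emod_nonneg i h0.ne'
    have h2 := Int.emod_lt_of_pos i h0
    let z : Σ j : Fin t, Fin (m j).toNat := ⟨j, ⟨(i % m j).toNat, by omega⟩⟩
    have h3 := hn z e (i / m j)
    have h4 : polyShift (i / m j) (p z.1 z.2) = p j i := by
      rw [hshift]
      congr 1
      simp only [z]
      rw [Int.toNat_of_nonneg h1]
      exact Int.emod_add_ediv_mul i (m j)
    rw [h4] at h3
    refine h3.trans (le_trans ?_ (le_sup_of_le_right (le_iSup _ z)))
    exact red_le_red ((frac_mono (hB z) (pow_dvd_pow _ he)).trans (frac_le_red _))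
  have hu' : u.map (ratShift k : RatFunc k →+* RatFunc k) ≠ 0 :=
    (Polynomial.map_ne_zero_iff (ratShift k).injective).mpr hu
  have hv' : v.map (ratShift k : RatFunc k →+* RatFunc k) ≠ 0 :=
    (Polynomial.map_ne_zero_iff (ratShift k).injective).mpr hv
  have hf' := hf
  rw [map_div₀, shiftX_algebraMap, shiftX_algebraMap] at hf'
  obtain ⟨f₁, d₁, d₂, N, hd₁, hd₂, h₁, h₂, hfd⟩ :=
    exists_denom_factorization hv hv' (isCoprime_map_shifts _ huv) hf'
  have hrange : ∀ s ∈ LinearMap.range (qdiff (algebraMap _ (RatFunc (RatFunc k)) u /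
      algebraMap _ (RatFunc (RatFunc k)) v)), twistX f s ∈ S := by
    rintro _ ⟨s, rfl⟩
    have : twistX f (qdiff (algebraMap _ (RatFunc (RatFunc k)) u /
        algebraMap _ (RatFunc (RatFunc k)) v) s) = qdiff (algebraMap _ (RatFunc (RatFunc k)) u /
        algebraMap _ (RatFunc (RatFunc k)) v) (twistX f s) := by
      rw [qdiff_apply, qdiff_apply, twistX_apply, twistX_apply, map_sub, map_mul, map_mul]
      change f * (_ * shiftX k (shiftY k s) - _) = _ * (shiftY k f * shiftY k (shiftX k s)) - _
      rw [shiftX_shiftY]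
      linear_combination shiftY k (shiftX k s) * hf
    rw [this]
    exact Submodule.mem_sup_left (qdiff_mem_red 1 _)
  have hfrac : ∀ {q : (RatFunc k)[X]} {e : ℕ}, Irreducible q → (∀ i : ℤ, red u v (polyShift i
      (q.map (ratShift k : RatFunc k →+* RatFunc k)) ^ e) ≤ S) → ∀ s ∈ frac (q ^ e),
      Irreducible (q.map (ratShift k : RatFunc k →+* RatFunc k)) → twistX f s ∈ S := by
    rintro q e hq hle _ ⟨A, rfl⟩ hq'
    obtain ⟨i, hi⟩ := exists_forall_mul_mem_red hu hv huv hd₁ hd₂ h₁ h₂ (f₁ := f₁) hq' e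
    refine hle i ?_
    rw [twistX_apply, hfd, divMap_apply, map_div₀, shiftX_algebraMap, shiftX_algebraMap,
      Polynomial.map_pow]
    exact hi _ (div_mem_frac _ _)
  refine ⟨B, hB, fun z => ?_, ?_, fun j i e he => (frac_le_red _).trans (hmem j i e he)⟩
  · rw [natDegree_pow, natDegree_polyShift]
    congr 1
    simp only [p]
    rw [toRatPoly_apply, natDegree_map_eq_of_injective (RatFunc.algebraMap_injective k), linShift,
      natDegree_linSub _ _ (hm _).ne', natDegree_polyShift]
  · change S ≤ S.comap (twistX f)
    conv_lhs => rw [hS]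
    refine sup_le (sup_le (fun s hs => ?_) hrange)
      (iSup_le fun z => sup_le (fun s hs => ?_) hrange)
    -- Polynomials are treated as fractions over the zeroth power of an arbitrary irreducible.
    · refine hfrac (q := X) (e := 0) irreducible_X (fun i => ?_) s (by simpa using hs)
        (by simpa using irreducible_X)
      rw [pow_zero]
      exact le_sup_left
    · simp only [B, hshift] at hs
      refine hfrac (hirr _ _) (fun i => ?_) s hs ?_
      · rw [map_ratShift_toRatPoly_linShift, hpdef, hshift]
        exact hmem _ _ _ le_rfl
      · rw [map_ratShift_toRatPoly_linShift]
        exact hirr _ _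

end Bivariate

/-! ### Coprimality from shift-reducedness -/

section Univariate

variable {F : Type*} [Field F] {u v : F[X]}

theorem ShiftReduced.isCoprime_polyShift {K : RatFunc F} (hK : ShiftReduced K)
    (huv : IsCoprime u v) (hv : v ≠ 0)
    (hKuv : K = algebraMap F[X] (RatFunc F) u / algebraMap F[X] (RatFunc F) v) (n : ℤ) :
    IsCoprime u (polyShift n v) := by
  have h1 : u * K.denom = v * K.num := by
    have h2 := RatFunc.algebraMap_ne_zero hv
    have h3 := RatFunc.algebraMap_ne_zero K.denom_ne_zero
    have h4 := K.num_div_denom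
    conv_rhs at h4 => rw [hKuv]
    rw [div_eq_div_iff h3 h2] at h4
    apply RatFunc.algebraMap_injective F
    rw [map_mul, map_mul]
    linear_combination -h4
  have h5 : u ∣ K.num := huv.dvd_of_dvd_mul_left (Dvd.intro _ h1)
  have h6 : v ∣ K.denom := huv.symm.dvd_of_dvd_mul_left (Dvd.intro _ h1.symm)
  exact ((hK.2 n).of_isCoprime_of_dvd_left h5).of_isCoprime_of_dvd_right
    (polyShift_dvd_polyShift n h6)

end Univariate

section Bivariate

variable {k : Type*} [Field k] {D : Type*} [CommRing D] [Algebra (RatFunc (RatFunc k)) D]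
  (E : DiffExt k D)

/-! ### Hypergeometric terms -/

theorem DiffExt.σx_smul (r : RatFunc (RatFunc k)) (d : D) :
    E.σx (r • d) = shiftX k r • E.σx d := by
  rw [Algebra.smul_def, map_mul, E.σx_algebraMap, Algebra.smul_def]

theorem DiffExt.σy_smul (r : RatFunc (RatFunc k)) (d : D) :
    E.σy (r • d) = shiftY k r • E.σy d := by
  rw [Algebra.smul_def, map_mul, E.σy_algebraMap, Algebra.smul_def]

theorem DiffExt.Δy_smul {H : D} {K : RatFunc (RatFunc k)} (hK : E.σy H = K • H)
    (s : RatFunc (RatFunc k)) : E.Δy (s • H) = qdiff K s • H := by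
  rw [DiffExt.Δy, E.σy_smul, hK, smul_smul, ← sub_smul, mul_comm, qdiff_apply]
  rfl

theorem DiffExt.iterate_σx_smul {H : D} {f : RatFunc (RatFunc k)} (hf : E.σx H = f • H)
    (s : RatFunc (RatFunc k)) (i : ℕ) : E.σx^[i] (s • H) = (twistX f)^[i] s • H := by
  induction i with
  | zero => rfl
  | succ i ih =>
    rw [Function.iterate_succ_apply', Function.iterate_succ_apply', ih, E.σx_smul, hf, smul_smul,
      twistX_apply, mul_comm]

variable {E}

theorem DiffExt.IsHypergeometric.smul {H : D} (hH : E.IsHypergeometric H)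
    {s : RatFunc (RatFunc k)} (hs : s ≠ 0) : E.IsHypergeometric (s • H) := by
  obtain ⟨h0, ⟨f, hf⟩, g, hg⟩ := hH
  refine ⟨smul_ne_zero hs h0, ⟨shiftX k s * f / s, ?_⟩, shiftY k s * g / s, ?_⟩
  · rw [E.σx_smul, hf, smul_smul, smul_smul, div_mul_cancel₀ _ hs]
  · rw [E.σy_smul, hg, smul_smul, smul_smul, div_mul_cancel₀ _ hs]

theorem DiffExt.IsHypergeometric.one [Nontrivial D] : E.IsHypergeometric (1 : D) :=
  ⟨one_ne_zero, ⟨1, by simp⟩, 1, by simp⟩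

/-- A linear relation modulo differences yields a telescoper. -/
theorem DiffExt.exists_isTelescoper_of_relation {H : D} (hH : E.IsHypergeometric H)
    {f K s : RatFunc (RatFunc k)} (hf : E.σx H = f • H) (hK : E.σy H = K • H) {n : ℕ}
    {e : Fin (n + 1) → RatFunc k} (he : e ≠ 0)
    (hrel : ∑ i, e i • (twistX f)^[(i : ℕ)] s ∈ LinearMap.range (qdiff K)) :
    ∃ L, E.IsTelescoper (s • H) L ∧ order L ≤ n := by
  obtain ⟨g, hg⟩ := hrel
  let L : ℕ →₀ RatFunc k := Finsupp.embDomain Fin.valEmbedding (Finsupp.equivFunOnFinite.symm e)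
  have happ : E.apply L (s • H) = qdiff K g • H := by
    rw [DiffExt.apply, Finsupp.sum_embDomain, Finsupp.sum_fintype _ _ fun i => by simp, hg,
      Finset.sum_smul]
    refine Finset.sum_congr rfl fun i _ => ?_
    rw [E.iterate_σx_smul hf, smul_smul]
    exact congrArg (· • H) (Algebra.smul_def (e i) ((twistX f)^[(i : ℕ)] s)).symm
  have hnt : Nontrivial D := ⟨⟨H, 0, hH.1⟩⟩
  refine ⟨L, ⟨?_, ?_⟩, ?_⟩
  · intro h
    rw [Finsupp.embDomain_eq_zero] at h
    exact he (Finsupp.equivFunOnFinite.symm.injective (h.trans (by ext; simp)))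
  -- If `g = 0`, then `g • H` is zero and not hypergeometric; the constant `1` serves as certificate
  -- since `Δ_y(1) = 0`.
  · rcases eq_or_ne g 0 with rfl | hg0
    · exact ⟨1, DiffExt.IsHypergeometric.one, by rw [happ, map_zero, zero_smul, DiffExt.Δy,
        map_one, sub_self]⟩
    · exact ⟨g • H, hH.smul hg0, by rw [happ, E.Δy_smul hK]⟩
  · refine Finset.sup_le fun i hi => ?_
    rw [Finsupp.support_embDomain, Finset.mem_map] at hi
    obtain ⟨j, _, rfl⟩ := hi
    exact Nat.le_of_lt_succ j.2

/-! ### Partial fractions of `b` and telescopers of bounded order -/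

variable [CharZero k]

theorem IsDecomp.irreducible_toRatPoly {b : (RatFunc k)[X]} {t : ℕ} {c : RatFunc k}
    {P : Fin t → k[X]} {l m : Fin t → ℤ} {ξ : Fin t → ℕ[X]} (h : IsDecomp b c P l m ξ)
    (j : Fin t) (i : ℤ) : Irreducible (toRatPoly (linShift (P j) (l j) (m j) i)) :=
  HypTel.irreducible_toRatPoly (monic_linShift (h.pos j).ne' (h.monic j) i)
    (irreducible_linShift (h.coprime j) (h.irreducible j) i)

theorem IsDecomp.isCoprime_toRatPoly {b : (RatFunc k)[X]} {t : ℕ} {c : RatFunc k}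
    {P : Fin t → k[X]} {l m : Fin t → ℤ} {ξ : Fin t → ℕ[X]} (h : IsDecomp b c P l m ξ)
    {j j' : Fin t} {i i' : ℤ} (hne : j = j' → i ≠ i') :
    IsCoprime (toRatPoly (linShift (P j) (l j) (m j) i))
      (toRatPoly (linShift (P j') (l j') (m j') i')) := by
  refine HypTel.isCoprime_toRatPoly (monic_linShift (h.pos j).ne' (h.monic j) i)
    (irreducible_linShift (h.coprime j) (h.irreducible j) i)
    (monic_linShift (h.pos j').ne' (h.monic j') i')
    (irreducible_linShift (h.coprime j') (h.irreducible j') i') fun heq => ?_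
  rcases eq_or_ne j j' with rfl | hj
  · exact hne rfl (linShift_injective (h.pos j).ne' (h.irreducible j) heq)
  · obtain ⟨x, y, hxy⟩ := exists_biShift_linSub_eq (h.coprime j) (P j) i
    obtain ⟨x', y', hxy'⟩ := exists_biShift_linSub_eq (h.coprime j') (P j') i'
    refine h.inequiv j j' hj (biShiftEquiv_trans ⟨x, y, rfl⟩ (biShiftEquiv_symm ⟨x', y', ?_⟩))
    rw [hxy, hxy', heq]

/-- Distinct indices give coprime factors, and `c` is a unit, so partial fractions reduce `b` to
prime powers with exponents at most the maximum coefficients. -/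
theorem IsDecomp.frac_le {b : (RatFunc k)[X]} (hb : b ≠ 0) {t : ℕ} {c : RatFunc k}
    {P : Fin t → k[X]} {l m : Fin t → ℤ} {ξ : Fin t → ℕ[X]} (h : IsDecomp b c P l m ξ)
    {S : Submodule (RatFunc k) (RatFunc (RatFunc k))} (hone : frac 1 ≤ S)
    (hS : ∀ j i, ∀ e ≤ maxCoeff (ξ j),
      frac (toRatPoly (linShift (P j) (l j) (m j) i) ^ e) ≤ S) : frac b ≤ S := by
  have hprod : ∏ j, toRatPoly (xiPow (P j) (l j) (m j) (ξ j)) =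
      ∏ z ∈ (Finset.univ.sigma fun j => (ξ j).support : Finset (Σ _ : Fin t, ℕ)),
        toRatPoly (linShift (P z.1) (l z.1) (m z.1) z.2) ^ (ξ z.1).coeff z.2 := by
    rw [Finset.prod_sigma]
    refine Finset.prod_congr rfl fun j _ => ?_
    rw [xiPow_eq, map_prod]
    simp only [map_pow]
  have hne : ∀ z ∈ (Finset.univ.sigma fun j => (ξ j).support : Finset (Σ _ : Fin t, ℕ)),
      toRatPoly (linShift (P z.1) (l z.1) (m z.1) z.2) ^ (ξ z.1).coeff z.2 ≠ 0 :=
    fun z _ => pow_ne_zero _ (h.irreducible_toRatPoly _ _).ne_zero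
  have hc : c ≠ 0 := by
    rintro rfl
    rw [h.eq, Polynomial.C_0, zero_mul] at hb
    exact hb rfl
  have hdvd : b ∣ ∏ j, toRatPoly (xiPow (P j) (l j) (m j) (ξ j)) := by
    rw [h.eq]
    exact ((isUnit_C.mpr hc.isUnit).mul_left_dvd).mpr dvd_rfl
  rw [hprod] at hdvd
  refine (frac_mono (Finset.prod_ne_zero_iff.mpr hne) hdvd).trans
    ((frac_prod_le _ _ hne ?_).trans (sup_le hone (iSup₂_le fun z hz => hS _ _ _ ?_)))
  · rintro ⟨j, i⟩ _ ⟨j', i'⟩ _ hzz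
    refine (h.isCoprime_toRatPoly fun hj hi => hzz ?_).pow
    have hi' : i = i' := by exact_mod_cast hi
    subst hj hi'
    rfl
  · exact Finset.le_sup (f := (ξ z.1).coeff) (Finset.mem_sigma.mp hz).2

/-- The existence of a telescoper of bounded order. -/
theorem exists_isTelescoper_order_le {T H : D} {K g : RatFunc (RatFunc k)}
    {u v a b q : (RatFunc k)[X]} (hH : E.IsHypergeometric H) (hKH : E.σy H = K • H)
    (hK : ShiftReduced K) (huv : IsCoprime u v)
    (hKuv : K = algebraMap _ (RatFunc (RatFunc k)) u / algebraMap _ (RatFunc (RatFunc k)) v)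
    (hb : b ≠ 0)
    (hred : T = E.Δy (g • H) +
      (algebraMap _ (RatFunc (RatFunc k)) a / algebraMap _ (RatFunc (RatFunc k)) b +
        algebraMap _ (RatFunc (RatFunc k)) q / algebraMap _ (RatFunc (RatFunc k)) v) • H)
    {t : ℕ} {c : RatFunc k} {P : Fin t → k[X]} {l m : Fin t → ℤ} {ξ : Fin t → ℕ[X]}
    (h : IsDecomp b c P l m ξ) :
    ∃ L, E.IsTelescoper T L ∧ (order L : ℤ) ≤ kernelBound u v +
      ∑ j, m j * (maxCoeff (ξ j) : ℤ) * ((P j).natDegree : ℤ) := by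
  have hu : u ≠ 0 := by
    rintro rfl
    exact hK.1 (by rw [hKuv, map_zero, zero_div])
  have hv : v ≠ 0 := by
    rintro rfl
    exact hK.1 (by rw [hKuv, map_zero, div_zero])
  have huv' := hK.isCoprime_polyShift huv hv hKuv
  obtain ⟨-, ⟨f, hf⟩, -⟩ := id hH
  have hcomm : shiftX k K * f = shiftY k f * K := by
    have h1 := E.comm H
    rw [hKH, hf, E.σx_smul, E.σy_smul, hf, hKH, smul_smul, smul_smul] at h1
    exact smul_left_injective _ hH.1 h1
  rw [hKuv] at hcomm
  obtain ⟨B, hB, hdeg, hinv, hfrac⟩ := exists_invariant_residual_space hu hv huv' hcomm P l m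
    (fun j => maxCoeff (ξ j)) h.pos h.irreducible_toRatPoly
  set S := red u v 1 ⊔ ⨆ z, red u v (B z)
  let s := algebraMap _ (RatFunc (RatFunc k)) a / algebraMap _ (RatFunc (RatFunc k)) b +
    algebraMap _ (RatFunc (RatFunc k)) q / algebraMap _ (RatFunc (RatFunc k)) v + qdiff K g
  have hTs : T = s • H := by
    rw [hred, E.Δy_smul hKH, add_comm, ← add_smul]
  have hone : red u v 1 ≤ S := le_sup_left
  have hs : s ∈ S := by
    refine Submodule.add_mem _ (Submodule.add_mem _ ?_ ?_) ?_
    · exact h.frac_le hb ((frac_le_red 1).trans hone) hfrac (div_mem_frac a b)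
    · exact hone (frac_denom_le_red huv hv one_ne_zero (div_mem_frac q v))
    · rw [hKuv]
      exact hone (qdiff_mem_red 1 g)
  have hiter : ∀ i : ℕ, (twistX f)^[i] s ∈ S := by
    intro i
    induction i with
    | zero => exact hs
    | succ i ih =>
      rw [Function.iterate_succ_apply']
      exact hinv _ ih
  have hsum : ∑ z, ((B z).natDegree : ℤ) =
      ∑ j, m j * (maxCoeff (ξ j) : ℤ) * ((P j).natDegree : ℤ) := by
    rw [Fintype.sum_sigma]
    refine Finset.sum_congr rfl fun j _ => ?_
    simp only [hdeg, Finset.sum_const, Finset.card_univ, Fintype.card_fin]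
    push_cast
    rw [nsmul_eq_mul, mul_assoc, ← Int.natCast_toNat_eq_self.mpr (h.pos j).le, Int.toNat_natCast]
  have hnonneg : 0 ≤ kernelBound u v + ∑ z, ((B z).natDegree : ℤ) :=
    add_nonneg kernelBound_nonneg (Finset.sum_nonneg fun _ _ => Int.natCast_nonneg _)
  obtain ⟨e, he, hrel⟩ := exists_relation hu hv huv' B hB
    (Int.toNat_of_nonneg hnonneg).ge (fun i => (twistX f)^[(i : ℕ)] s) fun i => hiter i
  rw [← hKuv] at hrel
  obtain ⟨L, hL, hord⟩ := DiffExt.exists_isTelescoper_of_relation hH hf hKH he hrel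
  refine ⟨L, hTs ▸ hL, ?_⟩
  rw [← hsum, ← Int.toNat_of_nonneg hnonneg]
  exact_mod_cast hord

end Bivariate

section Bivariate

variable {k : Type*} [Field k]

/-! ### Existence of decompositions -/

theorem xiPow_eq_of_subset (P : k[X]) (l m : ℤ) {ξ : ℕ[X]} {s : Finset ℕ} (h : ξ.support ⊆ s) :
    xiPow P l m ξ = ∏ i ∈ s, linShift P l m i ^ ξ.coeff i := by
  rw [xiPow_eq]
  refine Finset.prod_subset h fun i _ hi => ?_
  rw [notMem_support_iff.mp hi, pow_zero]

theorem xiPow_add (P : k[X]) (l m : ℤ) (ξ η : ℕ[X]) :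
    xiPow P l m (ξ + η) = xiPow P l m ξ * xiPow P l m η := by
  rw [xiPow_eq_of_subset P l m support_add,
    xiPow_eq_of_subset P l m (Finset.subset_union_left (s₂ := η.support)),
    xiPow_eq_of_subset P l m (Finset.subset_union_right (s₁ := ξ.support)),
    ← Finset.prod_mul_distrib]
  simp only [coeff_add, pow_add]

theorem xiPow_monomial (P : k[X]) (l m : ℤ) (n c : ℕ) :
    xiPow P l m (monomial n c) = linShift P l m n ^ c := by
  rw [xiPow_eq_of_subset P l m (support_monomial_subset n c), Finset.prod_singleton,
    coeff_monomial_same]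

/-- The base point of an orbit may be moved arbitrarily far left, which makes room for factors of
negative index although exponents live in `ℕ[δ]`. -/
theorem xiPow_polyShift_mul_X_pow (P : k[X]) (l m : ℤ) (ξ : ℕ[X]) (N : ℕ) :
    xiPow (polyShift (-(N : ℤ)) P) l m (ξ * X ^ N) = xiPow P l m ξ := by
  induction ξ using Polynomial.induction_on' with
  | add p q hp hq => rw [add_mul, xiPow_add, xiPow_add, hp, hq]
  | monomial n c =>
    rw [X_pow_eq_monomial, monomial_mul_monomial, mul_one, xiPow_monomial, xiPow_monomial,
      linShift_polyShift]
    congr 2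
    push_cast
    ring

theorem natDegree_linSub_zero (P : k[X]) (l : ℤ) : (linSub P l 0).natDegree = 0 := by
  rw [linSub_eq_comp, natDegree_comp, Int.cast_zero, map_zero, zero_mul, zero_add, natDegree_C,
    mul_zero]

theorem linSub_comp_C_mul_X (P : k[X]) (l m g : ℤ) :
    linSub (P.comp ((g : k[X]) * X)) l m = linSub P (g * l) (g * m) := by
  rw [linSub, linSub, aeval_comp]
  congr 2
  simp only [map_mul, map_intCast, aeval_X]
  push_cast
  ring

theorem linSub_C_mul (P : k[X]) (l m : ℤ) (c : k) :
    linSub (Polynomial.C c * P) l m = Polynomial.C (Polynomial.C c) * linSub P l m := by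
  rw [linSub, map_mul, aeval_C, IsScalarTower.algebraMap_apply k k[X] k[X][X], linSub]
  rfl

theorem isUnit_C_C {c : k} (hc : c ≠ 0) :
    IsUnit (Polynomial.C (Polynomial.C c) : k[X][X]) :=
  isUnit_C.mpr (isUnit_C.mpr hc.isUnit)

theorem IsDecomp.C_mul {b : (RatFunc k)[X]} {t : ℕ} {c : RatFunc k} {P : Fin t → k[X]}
    {l m : Fin t → ℤ} {ξ : Fin t → ℕ[X]} (h : IsDecomp b c P l m ξ) (c' : RatFunc k) :
    IsDecomp (Polynomial.C c' * b) (c' * c) P l m ξ where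
  pos := h.pos
  coprime := h.coprime
  irreducible := h.irreducible
  monic := h.monic
  inequiv := h.inequiv
  eq := by rw [h.eq, map_mul, mul_assoc]

theorem IsDecomp.cons {b : (RatFunc k)[X]} {t : ℕ} {c : RatFunc k} {P : Fin t → k[X]}
    {l m : Fin t → ℤ} {ξ : Fin t → ℕ[X]} (h : IsDecomp b c P l m ξ) {P₀ : k[X]} {l₀ m₀ : ℤ}
    (hm₀ : 0 < m₀) (hcop : IsCoprime l₀ m₀) (hmon : (linSub P₀ l₀ m₀).leadingCoeff.Monic)
    (hirr : Irreducible (linSub P₀ l₀ m₀))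
    (hne : ∀ j, ¬ BiShiftEquiv (linSub (P j) (l j) (m j)) (linSub P₀ l₀ m₀)) :
    IsDecomp (toRatPoly (linSub P₀ l₀ m₀) * b) c (Fin.cons P₀ P : Fin (t + 1) → k[X])
      (Fin.cons l₀ l : Fin (t + 1) → ℤ) (Fin.cons m₀ m : Fin (t + 1) → ℤ)
      (Fin.cons 1 ξ : Fin (t + 1) → ℕ[X]) where
  pos := Fin.cases hm₀ h.pos
  coprime := Fin.cases hcop h.coprime
  irreducible := Fin.cases hirr h.irreducible
  monic := Fin.cases hmon h.monic
  inequiv := by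
    refine Fin.cases (Fin.cases (fun h => absurd rfl h) fun j _ hj => ?_)
      fun i => Fin.cases (fun _ => hne i) fun j hij => ?_
    · exact hne j (biShiftEquiv_symm hj)
    · exact h.inequiv i j fun h => hij (congrArg Fin.succ h)
  eq := by
    have h1 : xiPow P₀ l₀ m₀ 1 = linSub P₀ l₀ m₀ := by
      have := xiPow_monomial P₀ l₀ m₀ 0 1
      rwa [monomial_zero_one, pow_one, Nat.cast_zero, linShift_zero] at this
    rw [Fin.prod_univ_succ, h.eq]
    simp only [Fin.cons_zero, Fin.cons_succ, h1]
    ring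

theorem toRatPoly_C (r : k[X]) :
    toRatPoly (Polynomial.C r) = Polynomial.C (algebraMap k[X] (RatFunc k) r) := by
  rw [toRatPoly_apply, Polynomial.map_C]

theorem exists_irreducible_dvd_natDegree_ne_zero {R : Type*} [CommRing R] [IsDomain R]
    [WfDvdMonoid R[X]] {p : R[X]} (hp : p.natDegree ≠ 0) :
    ∃ w, Irreducible w ∧ w ∣ p ∧ w.natDegree ≠ 0 := by
  induction p using WfDvdMonoid.induction_on_irreducible with
  | zero => simp at hp
  | unit u hu => exact absurd (natDegree_eq_zero_of_isUnit hu) hp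
  | mul a i ha hi ih =>
    by_cases hdeg : i.natDegree = 0
    · rw [natDegree_mul hi.ne_zero ha, hdeg, zero_add] at hp
      obtain ⟨w, hw, hwa, hdw⟩ := ih hp
      exact ⟨w, hw, hwa.mul_left i, hdw⟩
    · exact ⟨i, hi, dvd_mul_right i a, hdeg⟩

theorem DiffExt.exists_isMinimalTelescoper {D : Type*} [CommRing D]
    [Algebra (RatFunc (RatFunc k)) D] {E : DiffExt k D} {T : D} {L : ℕ →₀ RatFunc k}
    (hL : E.IsTelescoper T L) : ∃ L, E.IsMinimalTelescoper T L := by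
  obtain ⟨L', hL', hmin⟩ := WellFounded.has_min (measure (order (C := k))).wf
    {L | E.IsTelescoper T L} ⟨L, hL⟩
  exact ⟨L', hL', fun M hM => not_lt.mp (hmin M hM)⟩

variable [CharZero k]

/-- The normal form of an irreducible integer-linear polynomial that depends on `y`. -/
theorem exists_normal_form {P : k[X]} {l m : ℤ} (hirr : Irreducible (linSub P l m))
    (hdeg : (linSub P l m).natDegree ≠ 0) :
    ∃ (c : k) (P' : k[X]) (l' m' : ℤ), c ≠ 0 ∧ 0 < m' ∧ IsCoprime l' m' ∧
      (linSub P' l' m').leadingCoeff.Monic ∧ Irreducible (linSub P' l' m') ∧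
      linSub P l m = Polynomial.C (Polynomial.C c) * linSub P' l' m' := by
  have hm : m ≠ 0 := by
    rintro rfl
    exact hdeg (natDegree_linSub_zero P l)
  -- `g` is the gcd of `l` and `m` with the sign of `m`; it is absorbed into the univariate
  -- polynomial as `P(g z)`.
  obtain ⟨g, l', m', hm', hcop, rfl, rfl⟩ : ∃ g l' m' : ℤ, 0 < m' ∧ IsCoprime l' m' ∧
      l = g * l' ∧ m = g * m' := by
    have hg : (Int.gcd l m : ℤ) ≠ 0 := by
      exact_mod_cast (Int.gcd_pos_of_ne_zero_right l hm).ne'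
    obtain ⟨l₁, hl₁⟩ := Int.gcd_dvd_left l m
    obtain ⟨m₁, hm₁⟩ := Int.gcd_dvd_right l m
    have hcop : IsCoprime l₁ m₁ := by
      refine ⟨l.gcdA m, l.gcdB m, mul_left_cancel₀ hg ?_⟩
      have := Int.gcd_eq_gcd_ab l m
      linear_combination l.gcdA m * (-hl₁) + l.gcdB m * (-hm₁) - this
    have hm₁0 : m₁ ≠ 0 := by
      rintro rfl
      exact hm (by rw [hm₁, mul_zero])
    rcases lt_or_gt_of_ne hm₁0 with hneg | hpos
    · exact ⟨-(Int.gcd l m : ℤ), -l₁, -m₁, by omega, hcop.neg_neg, by linear_combination hl₁,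
        by linear_combination hm₁⟩
    · exact ⟨_, l₁, m₁, hpos, hcop, hl₁, hm₁⟩
  set Q := P.comp ((g : k[X]) * X) with hQ
  have hPQ : linSub P (g * l') (g * m') = linSub Q l' m' := (linSub_comp_C_mul_X P l' m' g).symm
  rw [hPQ] at hirr ⊢
  set c := Q.leadingCoeff * (m' : k) ^ Q.natDegree with hc
  have hQ0 : Q ≠ 0 := by
    intro h
    rw [h, linSub, map_zero] at hirr
    exact hirr.ne_zero rfl
  have hc0 : c ≠ 0 := mul_ne_zero (leadingCoeff_ne_zero.mpr hQ0)
    (pow_ne_zero _ (Int.cast_ne_zero.mpr hm'.ne'))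
  refine ⟨c, Polynomial.C c⁻¹ * Q, l', m', hc0, hm', hcop, ?_, ?_, ?_⟩
  · rw [monic_linSub_iff hm'.ne', leadingCoeff_mul, leadingCoeff_C,
      natDegree_C_mul (inv_ne_zero hc0), mul_assoc, ← hc, inv_mul_cancel₀ hc0]
  · rw [linSub_C_mul]
    exact (irreducible_isUnit_mul (isUnit_C_C (inv_ne_zero hc0))).mpr hirr
  · rw [linSub_C_mul, ← mul_assoc, ← map_mul, ← map_mul, mul_inv_cancel₀ hc0, map_one, map_one,
      one_mul]

/-- A factor from an orbit already present is included by moving the base point left by `N`, so that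
its index `i + N` becomes a natural number. -/
theorem IsDecomp.update {b : (RatFunc k)[X]} {t : ℕ} {c : RatFunc k} {P : Fin t → k[X]}
    {l m : Fin t → ℤ} {ξ : Fin t → ℕ[X]} (h : IsDecomp b c P l m ξ) (j : Fin t) (i : ℤ) (N : ℕ)
    (hN : 0 ≤ i + N) :
    IsDecomp (toRatPoly (linShift (P j) (l j) (m j) i) * b) c
      (Function.update P j (polyShift (-(N : ℤ)) (P j))) l m
      (Function.update ξ j (ξ j * X ^ N + monomial (i + N).toNat 1)) := by
  have hlin : ∀ j', linSub (Function.update P j (polyShift (-(N : ℤ)) (P j)) j') (l j') (m j') =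
      linShift (P j') (l j') (m j') (if j' = j then -N else 0) := by
    intro j'
    rcases eq_or_ne j' j with rfl | hj
    · rw [Function.update_self, if_pos rfl, linShift]
    · rw [Function.update_of_ne hj, if_neg hj, linShift_zero]
  have hequiv : ∀ j', BiShiftEquiv (linSub (P j') (l j') (m j'))
      (linSub (Function.update P j (polyShift (-(N : ℤ)) (P j)) j') (l j') (m j')) := by
    intro j'
    obtain ⟨x, y, hxy⟩ := exists_biShift_linSub_eq (h.coprime j') (P j') (if j' = j then -N else 0)
    exact ⟨x, y, by rw [hlin, hxy]⟩
  refine ⟨h.pos, h.coprime, fun j' => ?_, fun j' => ?_, fun i' j' hij hc => ?_, ?_⟩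
  · rw [hlin]
    exact irreducible_linShift (h.coprime j') (h.irreducible j') _
  · rw [hlin, (monic_linShift (h.pos j').ne' (h.monic j') _).leadingCoeff]
    exact monic_one
  · exact h.inequiv i' j' hij (biShiftEquiv_trans (biShiftEquiv_trans (hequiv i') hc)
      (biShiftEquiv_symm (hequiv j')))
  · have hfac : ∀ j', toRatPoly (xiPow (Function.update P j (polyShift (-(N : ℤ)) (P j)) j') (l j')
        (m j') (Function.update ξ j (ξ j * X ^ N + monomial (i + N).toNat 1) j')) =
        (if j' = j then toRatPoly (linShift (P j) (l j) (m j) i) else 1) *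
          toRatPoly (xiPow (P j') (l j') (m j') (ξ j')) := by
      intro j'
      rcases eq_or_ne j' j with rfl | hj
      · rw [Function.update_self, Function.update_self, if_pos rfl, xiPow_add,
          xiPow_polyShift_mul_X_pow, xiPow_monomial, linShift_polyShift, pow_one,
          Int.toNat_of_nonneg hN, add_neg_cancel_right, map_mul, mul_comm]
      · rw [Function.update_of_ne hj, Function.update_of_ne hj, if_neg hj, one_mul]
    simp only [hfac]
    rw [Finset.prod_mul_distrib, Finset.prod_ite_eq' Finset.univ j, if_pos (Finset.mem_univ j),
      h.eq]
    ring

theorem exists_isDecomp_mul {b : (RatFunc k)[X]} {t : ℕ} {c : RatFunc k} {P : Fin t → k[X]}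
    {l m : Fin t → ℤ} {ξ : Fin t → ℕ[X]} (h : IsDecomp b c P l m ξ) {P₀ : k[X]} {l₀ m₀ : ℤ}
    (hm₀ : 0 < m₀) (hcop : IsCoprime l₀ m₀) (hmon : (linSub P₀ l₀ m₀).leadingCoeff.Monic)
    (hirr : Irreducible (linSub P₀ l₀ m₀)) :
    ∃ (t : ℕ) (c : RatFunc k) (P : Fin t → k[X]) (l m : Fin t → ℤ) (ξ : Fin t → ℕ[X]),
      IsDecomp (toRatPoly (linSub P₀ l₀ m₀) * b) c P l m ξ := by
  by_cases hne : ∃ j, BiShiftEquiv (linSub (P j) (l j) (m j)) (linSub P₀ l₀ m₀)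
  · obtain ⟨j, x, y, hxy⟩ := hne
    rw [hxy, biShift_linSub]
    exact ⟨_, _, _, _, _, _, h.update j _ (-(x * l j + y * m j)).toNat (by omega)⟩
  · push Not at hne
    exact ⟨_, _, _, _, _, _, h.cons hm₀ hcop hmon hirr hne⟩

theorem exists_isDecomp_toRatPoly {p : k[X][X]} (hp : p ≠ 0) (hlin : PolyIntegerLinear p) :
    ∃ (t : ℕ) (c : RatFunc k) (P : Fin t → k[X]) (l m : Fin t → ℤ) (ξ : Fin t → ℕ[X]),
      IsDecomp (toRatPoly p) c P l m ξ := by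
  induction p using WfDvdMonoid.induction_on_irreducible with
  | zero => exact absurd rfl hp
  | unit u hu =>
    refine ⟨0, algebraMap k[X] (RatFunc k) (u.coeff 0), Fin.elim0, Fin.elim0, Fin.elim0, Fin.elim0,
      fun j => j.elim0, fun j => j.elim0, fun j => j.elim0, fun j => j.elim0, fun j => j.elim0, ?_⟩
    rw [← toRatPoly_C, ← eq_C_of_natDegree_eq_zero (natDegree_eq_zero_of_isUnit hu),
      Finset.univ_eq_empty, Finset.prod_empty, mul_one]
  | mul a i ha hi ih =>
    obtain ⟨t, c, P, l, m, ξ, h⟩ := ih ha fun f hf hfa => hlin f hf (hfa.mul_left i)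
    rw [map_mul]
    -- Irreducible factors free of `y` are units over `C(x)` and go into the constant.
    by_cases hdeg : i.natDegree = 0
    · rw [eq_C_of_natDegree_eq_zero hdeg, toRatPoly_C]
      exact ⟨_, _, _, _, _, _, h.C_mul _⟩
    · obtain ⟨P₁, l₁, m₁, rfl⟩ := hlin i hi (dvd_mul_right i a)
      obtain ⟨c₀, P₀, l₀, m₀, hc₀, hm₀, hcop, hmon, hirr, heq⟩ := exists_normal_form hi hdeg
      obtain ⟨t', c', P', l', m', ξ', h'⟩ := exists_isDecomp_mul h hm₀ hcop hmon hirr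
      rw [heq, map_mul, toRatPoly_C, mul_assoc]
      exact ⟨_, _, _, _, _, _, h'.C_mul _⟩

theorem exists_isDecomp {b : (RatFunc k)[X]} (hb : b ≠ 0)
    (hlin : RatIntegerLinear (algebraMap (RatFunc k)[X] (RatFunc (RatFunc k)) b)) :
    ∃ (t : ℕ) (c : RatFunc k) (P : Fin t → k[X]) (l m : Fin t → ℤ) (ξ : Fin t → ℕ[X]),
      IsDecomp b c P l m ξ := by
  obtain ⟨p, d, hd, hpd, hp, hdl, heq⟩ := hlin
  have hd' : toRatPoly d ≠ 0 := (map_ne_zero_iff _ toRatPoly_injective).mpr hd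
  have hmul : b * toRatPoly d = toRatPoly p := by
    apply RatFunc.algebraMap_injective (RatFunc k)
    rw [map_mul, heq, div_mul_cancel₀ _ (RatFunc.algebraMap_ne_zero hd')]
  have hp0 : p ≠ 0 := by
    rintro rfl
    rw [map_zero] at hmul
    exact mul_ne_zero hb hd' hmul
  -- An irreducible factor of `d` that involves `y` is monic in `y` up to a constant. It would
  -- divide `p` over `C(x)`, hence over `C[x]` by Gauss's lemma, against the coprimality of `p` and
  -- `d`.
  have hdeg : d.natDegree = 0 := by
    by_contra hdeg
    obtain ⟨w, hw, hwd, hw0⟩ := exists_irreducible_dvd_natDegree_ne_zero hdeg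
    obtain ⟨P, l, m, rfl⟩ := hdl w hw hwd
    obtain ⟨c₀, P₀, l₀, m₀, hc₀, hm₀, hcop, hmon, hirr, heq₀⟩ := exists_normal_form hw hw0
    have h1 : linSub P₀ l₀ m₀ ∣ d := (Dvd.intro_left _ heq₀.symm).trans hwd
    have h2 : (linSub P₀ l₀ m₀).Monic := by
      simpa using monic_linShift hm₀.ne' hmon 0
    have h3 : linSub P₀ l₀ m₀ ∣ p := by
      refine h2.isPrimitive.dvd_of_fraction_map_dvd_fraction_map (K := RatFunc k) ?_
      change toRatPoly _ ∣ toRatPoly _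
      rw [← hmul]
      exact (_root_.map_dvd _ h1).mul_left b
    exact hirr.not_isUnit (hpd h3 h1)
  obtain ⟨t, c, P, l, m, ξ, h⟩ := exists_isDecomp_toRatPoly hp0 hp
  rw [eq_C_of_natDegree_eq_zero hdeg, toRatPoly_C] at hmul hd'
  have hr : algebraMap k[X] (RatFunc k) (d.coeff 0) ≠ 0 := fun h => hd' (by rw [h, map_zero])
  have hb' : b = Polynomial.C (algebraMap k[X] (RatFunc k) (d.coeff 0))⁻¹ * toRatPoly p := by
    rw [← hmul, mul_comm b, ← mul_assoc, ← map_mul, inv_mul_cancel₀ hr, map_one, one_mul]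
  rw [hb']
  exact ⟨_, _, _, _, _, _, h.C_mul _⟩

end Bivariate

end HypTel

/-! ### The bound for minimal telescopers -/

theorem mainTheorem1 {C : Type*} [Field C] [CharZero C]
    {D : Type*} [CommRing D] [Algebra (RatFunc (RatFunc C)) D] (E : DiffExt C D)
    (T H : D) (S K g : RatFunc (RatFunc C)) (u v a b q : (RatFunc C)[X])
    (hT : E.IsHypergeometric T) (hH : E.IsHypergeometric H) (hTSH : T = S • H)
    (hKH : E.σy H = K • H) (hK : ShiftReduced K) (huv : IsCoprime u v)
    (hKuv : K = algebraMap (RatFunc C)[X] (RatFunc (RatFunc C)) u / algebraMap (RatFunc C)[X] _ v)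
    (hres : IsResidual u v a b q)
    (hred : T = E.Δy (g • H) +
      (algebraMap (RatFunc C)[X] (RatFunc (RatFunc C)) a / algebraMap (RatFunc C)[X] _ b +
        algebraMap (RatFunc C)[X] _ q / algebraMap (RatFunc C)[X] _ v) • H)
    (hb : RatIntegerLinear (algebraMap (RatFunc C)[X] (RatFunc (RatFunc C)) b)) :
    (∃ (t : ℕ) (c : RatFunc C) (P : Fin t → C[X]) (lam mu : Fin t → ℤ) (ξ : Fin t → ℕ[X]),
      IsDecomp b c P lam mu ξ) ∧
    (∃ L, E.IsMinimalTelescoper T L) ∧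
    ∀ (t : ℕ) (c : RatFunc C) (P : Fin t → C[X]) (lam mu : Fin t → ℤ) (ξ : Fin t → ℕ[X]),
      IsDecomp b c P lam mu ξ → ∀ L, E.IsMinimalTelescoper T L →
        (order L : ℤ) ≤ kernelBound u v +
          ∑ j, mu j * (maxCoeff (ξ j) : ℤ) * ((P j).natDegree : ℤ) := by
  have hb0 := hres.shiftFree.1
  have htel : ∀ (t : ℕ) (c : RatFunc C) (P : Fin t → C[X]) (lam mu : Fin t → ℤ)
      (ξ : Fin t → ℕ[X]), IsDecomp b c P lam mu ξ → ∃ L, E.IsTelescoper T L ∧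
        (order L : ℤ) ≤ kernelBound u v +
          ∑ j, mu j * (maxCoeff (ξ j) : ℤ) * ((P j).natDegree : ℤ) :=
    fun _ _ _ _ _ _ h => exists_isTelescoper_order_le hH hKH hK huv hKuv hb0 hred h
  obtain ⟨t, c, P, lam, mu, ξ, h⟩ := exists_isDecomp hb0 hb
  obtain ⟨L, hL, -⟩ := htel t c P lam mu ξ h
  refine ⟨⟨t, c, P, lam, mu, ξ, h⟩, DiffExt.exists_isMinimalTelescoper hL, ?_⟩
  intro t c P lam mu ξ h L hL
  obtain ⟨L', hL', hord⟩ := htel t c P lam mu ξ h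
  exact (Int.ofNat_le.mpr (hL.2 L' hL')).trans hord
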